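/- Let $X$ be a real random variable with a symmetric, log-concave distribution, i.e. $X$ has a probability density $f$ with $f(-x)=f(x)$ for all $x$ and $f=e^{-V}$ for some convex $V:\mathbb{R}\to\mathbb{R}\cup\{\infty\}$. Let $p\in(0,2]$ and $q\in\left(\frac{1}{1+p},1\right)$. Put $$\beta=\Big(\frac{q}{1-q}-\frac1p\Big)^{-1}>0,\qquad A_{p,q}=\frac{2p^{1/p}\,\Gamma\!\left(1+\frac1p\right)}{\beta^{1/p}}\cdot\frac{\Gamma\!\left(\frac1{1-q}-\frac1p\right)}{\Gamma\!\left(\frac1{1-q}\right)},$$ and let $Z_{p,q}$ be a random variable with the generalized Gaussian density $$g_{p,q}(x)=A_{p,q}^{-1}\Big(1+\frac{\beta}{p}|x|^p\Big)^{-\frac1{1-q}},\qquad x\in\mathbb{R},$$ which is a probability density. For probability densities $f,u$ on $\mathbb{R}$, let $$I_q(f\|u)=\frac{q}{1-q}\log\int_{\mathbb{R}}\frac{f}{\|f\|_q}\Big(\frac{u}{\|u\|_q}\Big)^{q-1}dx,\qquad \|f\|_q=\Big(\int_{\mathbb{R}} f^q\,dx\Big)^{1/q},$$ be the relative $q$-entropy,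 and write $I_q(X\|Z)$ for the relative $q$-entropy between the densities of $X$ and $Z$. Then $0<\mathbb{E}|X|^p<\infty$, and there is a multiple $Z=cZ_{p,q}$ with $c>0$ and $\mathbb{E}|Z|^p=\mathbb{E}|X|^p$. For every multiple $Z=cZ_{p,q}$, $c\in\mathbb{R}$, with $\mathbb{E}|Z|^p=\mathbb{E}|X|^p$, the quantities $\|\cdot\|_q$ of the densities of $X$ and of $Z$ are finite, and $$I_q(X\|Z)\le\log\left[A_{p,q}\,\frac{\left(1+\frac{\beta}{p}\right)^{\frac1{1-q}}}{2(p+1)^{1/p}}\right],$$ with equality if and only if $X$ is uniformly distributed on a symmetric interval $[-a,a]$, $a>0$. -/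

import Mathlib

open MeasureTheory ProbabilityTheory
open scoped ENNReal

noncomputable section

namespace SymmLogConcave

/-- `f` is a symmetric log-concave probability density on the real line. Log-concavity, that is
`f = exp (-V)` with `V : ℝ → ℝ ∪ {∞}` convex, is written multiplicatively, so that zeros of `f`
(points where `V = ∞`) are allowed. -/
structure IsSymmLogConcaveDensity (f : ℝ → ℝ) : Prop where
  measurable : Measurable f
  nonneg : ∀ x, 0 ≤ f x
  lintegral_eq_one : ∫⁻ x, ENNReal.ofReal (f x) = 1
  symm : ∀ x, f (-x) = f x
  logConcave : ∀ x y a b : ℝ, 0 < a → 0 < b → a + b = 1 →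
    f x ^ a * f y ^ b ≤ f (a * x + b * y)

/-- The random variable `X` has a symmetric log-concave distribution. -/
def HasSymmLogConcaveDistribution {Ω : Type*} [MeasurableSpace Ω] (X : Ω → ℝ) (P : Measure Ω) :
    Prop :=
  AEMeasurable X P ∧ ∃ f : ℝ → ℝ, IsSymmLogConcaveDensity f ∧
    P.map X = volume.withDensity (fun x => ENNReal.ofReal (f x))

/-- The absolute `p`-th moment `E |X| ^ p`, as an extended nonnegative real. -/
def absMoment {Ω : Type*} [MeasurableSpace Ω] (p : ℝ) (X : Ω → ℝ) (P : Measure Ω) : ℝ≥0∞ :=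
  ∫⁻ ω, ENNReal.ofReal (|X ω| ^ p) ∂P

/-- `‖f‖_q = (∫ f ^ q) ^ (1 / q)` with respect to Lebesgue measure. -/
def qNorm (q : ℝ) (f : ℝ → ℝ≥0∞) : ℝ≥0∞ :=
  eLpNorm f (ENNReal.ofReal q) volume

/-- The relative `q`-entropy
`I_q(f‖u) = q / (1 - q) * log ∫ (f / ‖f‖_q) * (u / ‖u‖_q) ^ (q - 1)` of two densities. -/
def relEntropy (q : ℝ) (f u : ℝ → ℝ≥0∞) : EReal :=
  ((q / (1 - q) : ℝ) : EReal) *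
    ENNReal.log (∫⁻ x, (f x / qNorm q f) * (u x / qNorm q u) ^ (q - 1))

/-- The parameter `β`, given by `1 / β = q / (1 - q) - 1 / p`. -/
def beta (p q : ℝ) : ℝ := (q / (1 - q) - 1 / p)⁻¹

/-- The constant `A_{p,1} = 2 p ^ (1 / p) Γ(1 + 1 / p)`. -/
def normConstOne (p : ℝ) : ℝ := 2 * p ^ (1 / p) * Real.Gamma (1 + 1 / p)

/-- The normalizing constant `A_{p,q}`, for `q < 1`. -/
def normConst (p q : ℝ) : ℝ :=
  normConstOne p / beta p q ^ (1 / p) *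
    (Real.Gamma (1 / (1 - q) - 1 / p) / Real.Gamma (1 / (1 - q)))

/-- The generalized standard Gaussian density `g_{p,q}`, for `q < 1`. -/
def genGaussianDensity (p q x : ℝ) : ℝ :=
  (normConst p q)⁻¹ * (1 + beta p q / p * |x| ^ p) ^ (-(1 / (1 - q)))

/-- The generalized standard Gaussian distribution, that is, the law of `Z_{p,q}`. -/
def genGaussian (p q : ℝ) : Measure ℝ :=
  volume.withDensity (fun x => ENNReal.ofReal (genGaussianDensity p q x))

end SymmLogConcave

end

namespace SymmLogConcave

open Set Filter Topology

/-! The density u of Z has u^(q-1) affine in |x|^p, so its integral against f depends only on the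
mass and the p-th moment. Hence I_q(X‖Z) is the difference of the Rényi entropies of order q of Z
and X (`relEntropy_eq`). The first is explicit. What remains is a sharp lower bound for the second,
2((p+1) E|X|^p)^(1/p) ≤ (∫ f^q)^(1/(1-q)), with equality exactly for uniform laws
(`two_mul_moment_le_rpow`, `two_mul_moment_eq_rpow_iff`).

With h the Shannon entropy of X, the bound is the chain 2((p+1) E|X|^p)^(1/p) ≤ 2(3 E X²)^(1/2) ≤
e^h ≤ (∫ f^q)^(1/(1-q)). The first link is concavity of t^(p/2) after an integration by parts; in
other words, f is a mixture of symmetric uniform densities (`moment_le_rpow_variance`). The last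
link is Jensen's inequality (`rpow_mul_exp_le_integral_rpow`).

The middle link is the core. Put e = h + log f(0), which is `excessEntropy f` and lies in [0, 1]. A
cubic bound 12 E X² f(0)² ≤ 1 + 2e + 3e²/2 + 3e³/2 (`twelve_mul_variance_le`) is compared with
exp(2e); the comparison is strict for e > 0, which settles the equality case. The cubic bound says
that f(x) * `levelPoly` x a c - ∫_{z>x} 3z² f(z) dz is nonnegative at x = 0, where a and c are the
tail mass and tail entropy divided by f(x). The part (x+a)³ + 3(x+a)c² + 2c³ - x³ of `levelPoly`
gives the exact tail integral when f is constant and then exponential beyond x. The remaining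
summand vanishes for c = 0 and for c = a, and makes the right derivative of the whole quantity
nonpositive. At the end of the support the quantity has a nonnegative limiting lower bound, so it is
nonnegative at 0. -/

/-! ### Integrals of even functions and derivatives of tail integrals. -/

lemma integrable_comp_abs_of_integrableOn_Ioi {g : ℝ → ℝ} (hg : IntegrableOn g (Ioi 0)) :
    Integrable (fun x => g |x|) := by
  have h1 : IntegrableOn (fun x => g |x|) (Ioi 0) :=
    hg.congr_fun (fun x hx => by simp [abs_of_pos (mem_Ioi.1 hx)]) measurableSet_Ioi
  have h2 : IntegrableOn (fun x => g |x|) (Iic 0) := by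
    have := IntegrableOn.comp_neg_Iic (c := (0 : ℝ))
      (f := fun x => g |x|) (by simpa using (integrableOn_Ici_iff_integrableOn_Ioi (by simp)).2 h1)
    simpa using this
  rw [← integrableOn_univ, ← Iic_union_Ioi (a := (0 : ℝ))]
  exact h2.union h1

lemma integrable_abs_rpow_mul_exp_neg {r k : ℝ} (hr : -1 < r) (hk : 0 < k) :
    Integrable (fun x : ℝ => |x| ^ r * Real.exp (-k * |x|)) := by
  apply integrable_comp_abs_of_integrableOn_Ioi (g := fun x : ℝ => x ^ r * Real.exp (-k * x))
  simpa using integrableOn_rpow_mul_exp_neg_mul_rpow hr one_pos hk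

/-- The tail integral of an integrable function has derivative `-h x` at continuity points. -/
lemma hasDerivAt_integral_Ioi {h : ℝ → ℝ} (hh : Integrable h) (hm : Measurable h) {x : ℝ}
    (hc : ContinuousAt h x) : HasDerivAt (fun y => ∫ z in Ioi y, h z) (-h x) x := by
  have h1 : (fun y => ∫ z in Ioi y, h z) =
      fun y => (∫ z in Ioi x, h z) - ∫ z in x..y, h z := by
    funext y
    rw [intervalIntegral.integral_Ioi_sub_Ioi' hh.integrableOn hh.integrableOn |>.symm]
    ring
  rw [h1]
  have h2 := intervalIntegral.integral_hasDerivAt_right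
    (hh.intervalIntegrable (a := x) (b := x))
    hm.stronglyMeasurable.stronglyMeasurableAtFilter hc
  simpa using h2.const_sub (∫ z in Ioi x, h z)

/-! ### Monotonicity, exponential decay and integrability of the density. -/

namespace IsSymmLogConcaveDensity

variable {f : ℝ → ℝ}

lemma integrable (hf : IsSymmLogConcaveDensity f) : Integrable f := by
  refine ⟨hf.measurable.aestronglyMeasurable, ?_⟩
  rw [hasFiniteIntegral_iff_ofReal (ae_of_all _ hf.nonneg), hf.lintegral_eq_one]
  exact ENNReal.one_lt_top

lemma integral_eq_one (hf : IsSymmLogConcaveDensity f) : ∫ x, f x = 1 := by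
  rw [integral_eq_lintegral_of_nonneg_ae (ae_of_all _ hf.nonneg)
    hf.measurable.aestronglyMeasurable, hf.lintegral_eq_one, ENNReal.toReal_one]

lemma apply_abs (hf : IsSymmLogConcaveDensity f) (x : ℝ) : f |x| = f x := by
  rcases abs_choice x with h | h <;> rw [h]
  exact hf.symm x

/-- A point of [0, y] is a convex combination of y and -y, where f takes the same value. -/
lemma antitoneOn (hf : IsSymmLogConcaveDensity f) : AntitoneOn f (Ici 0) := by
  intro x hx y hy hxy
  rcases hxy.eq_or_lt with rfl | hlt
  · exact le_rfl
  have hx0 : 0 ≤ x := hx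
  have hy0 : 0 < y := lt_of_le_of_lt hx0 hlt
  have hxy1 : x / y < 1 := (div_lt_one hy0).2 hlt
  have hxy0 : 0 ≤ x / y := by positivity
  have h := hf.logConcave y (-y) ((1 + x / y) / 2) ((1 - x / y) / 2)
    (by linarith) (by linarith) (by ring)
  rw [hf.symm] at h
  have e : (1 + x / y) / 2 * y + (1 - x / y) / 2 * -y = x := by field_simp; ring
  rw [e] at h
  rcases (hf.nonneg y).eq_or_lt with h0 | h0
  · rw [← h0]; exact hf.nonneg x
  rw [← Real.rpow_add h0] at h
  have e2 : (1 + x / y) / 2 + (1 - x / y) / 2 = 1 := by ring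
  rwa [e2, Real.rpow_one] at h

lemma apply_le_apply_zero (hf : IsSymmLogConcaveDensity f) (x : ℝ) : f x ≤ f 0 := by
  rw [← hf.apply_abs x]
  exact hf.antitoneOn (mem_Ici.2 le_rfl) (mem_Ici.2 (abs_nonneg x)) (abs_nonneg x)

lemma apply_zero_pos (hf : IsSymmLogConcaveDensity f) : 0 < f 0 := by
  by_contra h
  have : ∀ x, f x = 0 := fun x =>
    le_antisymm ((hf.apply_le_apply_zero x).trans (not_lt.1 h)) (hf.nonneg x)
  have h1 := hf.integral_eq_one
  simp [this] at h1

lemma convex_pos (hf : IsSymmLogConcaveDensity f) : Convex ℝ {x | 0 < f x} := by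
  rw [convex_iff_forall_pos]
  intro x hx y hy a b ha hb hab
  exact lt_of_lt_of_le (mul_pos (Real.rpow_pos_of_pos hx a) (Real.rpow_pos_of_pos hy b))
    (hf.logConcave x y a b ha hb hab)

lemma convexOn_neg_log (hf : IsSymmLogConcaveDensity f) :
    ConvexOn ℝ {x | 0 < f x} (fun x => -Real.log (f x)) := by
  rw [convexOn_iff_forall_pos]
  refine ⟨hf.convex_pos, ?_⟩
  intro x hx y hy a b ha hb hab
  have hx' : 0 < f x := hx
  have hy' : 0 < f y := hy
  have h := Real.log_le_log (by positivity) (hf.logConcave x y a b ha hb hab)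
  rw [Real.log_mul (by positivity) (by positivity), Real.log_rpow hx', Real.log_rpow hy'] at h
  simp only [smul_eq_mul]
  linarith

lemma exists_pos_apply_lt_half (hf : IsSymmLogConcaveDensity f) :
    ∃ x, 0 < x ∧ f x ≤ f 0 / 2 := by
  by_contra! h
  have h0 := hf.apply_zero_pos
  have hle : ∀ x, f 0 / 2 ≤ f x := by
    intro x
    rw [← hf.apply_abs x]
    rcases (abs_nonneg x).eq_or_lt with hx | hx
    · rw [← hx]; linarith
    · exact (h _ hx).le
  have : Integrable (fun _ : ℝ => f 0 / 2) := by
    refine hf.integrable.mono' aestronglyMeasurable_const (ae_of_all _ fun x => ?_)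
    rw [Real.norm_of_nonneg (by linarith)]
    exact hle x
  rw [integrable_const_iff] at this
  rcases this with h | h
  · linarith
  · have := h.measure_univ_lt_top
    simp at this

/-- A symmetric log-concave density decays exponentially. -/
lemma exists_exp_bound (hf : IsSymmLogConcaveDensity f) :
    ∃ C k : ℝ, 0 < C ∧ 0 < k ∧ ∀ x, f x ≤ C * Real.exp (-k * |x|) := by
  obtain ⟨x₁, hx₁, hfx⟩ := hf.exists_pos_apply_lt_half
  have h0 := hf.apply_zero_pos
  have hl2 : 0 < Real.log 2 := Real.log_pos one_lt_two
  refine ⟨2 * f 0, Real.log 2 / x₁, by positivity, by positivity, fun x => ?_⟩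
  rw [← hf.apply_abs x]
  set z := |x| with hz
  have hz0 : 0 ≤ z := abs_nonneg x
  rcases le_or_gt z x₁ with hle | hgt
  · have h1 : Real.exp (-Real.log 2) ≤ Real.exp (-(Real.log 2 / x₁) * z) := by
      apply Real.exp_le_exp.2
      have : Real.log 2 / x₁ * z ≤ Real.log 2 / x₁ * x₁ := by gcongr
      rw [div_mul_cancel₀ _ hx₁.ne'] at this
      linarith
    rw [Real.exp_neg, Real.exp_log two_pos] at h1
    have h2 := hf.apply_le_apply_zero z
    nlinarith
  · have hzp : 0 < z := hx₁.trans hgt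
    rcases (hf.nonneg z).eq_or_lt with h | hfz
    · rw [← h]; positivity
    have ht1 : x₁ / z < 1 := (div_lt_one hzp).2 hgt
    -- Since x₁ lies between 0 and z, log-concavity turns the drop by log 2 on [0, x₁] into a drop
    -- of at least (z / x₁) log 2 on [0, z].
    have h := hf.logConcave z 0 (x₁ / z) (1 - x₁ / z) (by positivity) (by linarith) (by ring)
    rw [mul_zero, add_zero, div_mul_cancel₀ _ hzp.ne'] at h
    have h3 := Real.log_le_log (by positivity) (h.trans hfx)
    rw [Real.log_mul (by positivity) (by positivity), Real.log_rpow hfz, Real.log_rpow h0,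
      Real.log_div h0.ne' two_ne_zero] at h3
    have h4 : Real.log (f z) ≤ Real.log (f 0) - Real.log 2 / x₁ * z := by
      have h5 : x₁ / z * (Real.log (f z) - Real.log (f 0)) ≤ -Real.log 2 := by linarith
      have h6 := mul_le_mul_of_nonneg_left h5 (show 0 ≤ z / x₁ by positivity)
      have e1 : z / x₁ * (x₁ / z * (Real.log (f z) - Real.log (f 0))) =
        Real.log (f z) - Real.log (f 0) := by field_simp
      have e2 : z / x₁ * -Real.log 2 = -(Real.log 2 / x₁ * z) := by ring
      rw [e1, e2] at h6
      linarith
    have h7 : f z ≤ f 0 * Real.exp (-(Real.log 2 / x₁) * z) := by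
      rw [← Real.exp_log hfz, ← Real.exp_log h0, ← Real.exp_add]
      apply Real.exp_le_exp.2
      linarith
    have h8 := Real.exp_pos (-(Real.log 2 / x₁) * z)
    nlinarith

lemma integrable_abs_rpow_mul_rpow (hf : IsSymmLogConcaveDensity f) {r q : ℝ} (hr : 0 ≤ r)
    (hq : 0 < q) : Integrable (fun x => |x| ^ r * f x ^ q) := by
  obtain ⟨C, k, hC, hk, hb⟩ := hf.exists_exp_bound
  have hi := (integrable_abs_rpow_mul_exp_neg (r := r) (k := k * q) (by linarith)
    (by positivity)).const_mul (C ^ q)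
  have := hf.measurable
  refine hi.mono' (by fun_prop) (ae_of_all _ fun x => ?_)
  have h0 : 0 ≤ |x| ^ r * f x ^ q :=
    mul_nonneg (by positivity) (Real.rpow_nonneg (hf.nonneg x) q)
  rw [Real.norm_of_nonneg h0]
  have h1 : f x ^ q ≤ C ^ q * Real.exp (-(k * q) * |x|) := by
    calc f x ^ q ≤ (C * Real.exp (-k * |x|)) ^ q :=
          Real.rpow_le_rpow (hf.nonneg x) (hb x) hq.le
      _ = C ^ q * Real.exp (-(k * q) * |x|) := by
          rw [Real.mul_rpow hC.le (Real.exp_pos _).le, ← Real.exp_mul]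
          congr 2; ring
  calc |x| ^ r * f x ^ q ≤ |x| ^ r * (C ^ q * Real.exp (-(k * q) * |x|)) := by gcongr
    _ = _ := by ring

lemma integrable_rpow (hf : IsSymmLogConcaveDensity f) {q : ℝ} (hq : 0 < q) :
    Integrable (fun x => f x ^ q) := by
  simpa using hf.integrable_abs_rpow_mul_rpow (le_refl (0 : ℝ)) hq

lemma integrable_abs_rpow_mul (hf : IsSymmLogConcaveDensity f) {r : ℝ} (hr : 0 ≤ r) :
    Integrable (fun x => |x| ^ r * f x) := by
  simpa using hf.integrable_abs_rpow_mul_rpow hr one_pos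

lemma integrable_sq_mul (hf : IsSymmLogConcaveDensity f) :
    Integrable (fun x => x ^ 2 * f x) := by
  simpa using hf.integrable_abs_rpow_mul (r := 2) (by norm_num)

lemma log_sub_log_mul_nonneg (hf : IsSymmLogConcaveDensity f) (x : ℝ) :
    0 ≤ (Real.log (f 0) - Real.log (f x)) * f x := by
  rcases (hf.nonneg x).eq_or_lt with h | h
  · simp [← h]
  · have := Real.log_le_log h (hf.apply_le_apply_zero x)
    exact mul_nonneg (by linarith) h.le

lemma integrable_log_sub_log_mul (hf : IsSymmLogConcaveDensity f) :
    Integrable (fun x => (Real.log (f 0) - Real.log (f x)) * f x) := by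
  have h0 := hf.apply_zero_pos
  have hi := (hf.integrable_rpow (q := 1 / 2) (by norm_num)).const_mul (2 * f 0 ^ (1 / 2 : ℝ))
  have := hf.measurable
  refine hi.mono' (by fun_prop) (ae_of_all _ fun x => ?_)
  rw [Real.norm_of_nonneg (hf.log_sub_log_mul_nonneg x)]
  rcases (hf.nonneg x).eq_or_lt with h | h
  · simp [← h]
  -- Taking the square root of the ratio before using log t ≤ t - 1 leaves a bound by a multiple of
  -- f^(1/2), which is integrable by exponential decay.
  have h1 := Real.log_le_sub_one_of_pos (x := (f 0 / f x) ^ (1 / 2 : ℝ)) (by positivity)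
  rw [Real.log_rpow (by positivity), Real.log_div h0.ne' h.ne', Real.div_rpow h0.le h.le] at h1
  have h2 : f x = f x ^ (1 / 2 : ℝ) * f x ^ (1 / 2 : ℝ) := by
    rw [← Real.rpow_add h]; norm_num
  have h3 : 0 < f x ^ (1 / 2 : ℝ) := by positivity
  calc (Real.log (f 0) - Real.log (f x)) * f x
      ≤ (2 * (f 0 ^ (1 / 2 : ℝ) / f x ^ (1 / 2 : ℝ))) * f x := by
        gcongr; linarith
    _ = (2 * (f 0 ^ (1 / 2 : ℝ) / f x ^ (1 / 2 : ℝ))) *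
          (f x ^ (1 / 2 : ℝ) * f x ^ (1 / 2 : ℝ)) := by rw [← h2]
    _ = 2 * f 0 ^ (1 / 2 : ℝ) * f x ^ (1 / 2 : ℝ) := by field_simp

lemma integrable_log_mul (hf : IsSymmLogConcaveDensity f) :
    Integrable (fun x => Real.log (f x) * f x) := by
  refine ((hf.integrable.const_mul (Real.log (f 0))).sub
    hf.integrable_log_sub_log_mul).congr (ae_of_all _ fun x => ?_)
  simp only [Pi.sub_apply]
  ring

lemma Icc_subset_pos (hf : IsSymmLogConcaveDensity f) {y : ℝ} (hy : 0 < f y) :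
    Icc (-y) y ⊆ {x | 0 < f x} :=
  hf.convex_pos.ordConnected.out (show 0 < f (-y) by rwa [hf.symm]) hy

lemma zero_mem_interior_pos (hf : IsSymmLogConcaveDensity f) :
    (0 : ℝ) ∈ interior {x | 0 < f x} := by
  have : ∃ y, 0 < y ∧ 0 < f y := by
    by_contra! h
    have h1 : f =ᵐ[volume] 0 := by
      filter_upwards [compl_mem_ae_iff.2 (measure_singleton (0 : ℝ) (μ := volume))] with x hx
      rw [← hf.apply_abs]
      exact le_antisymm (h _ (abs_pos.2 hx)) (hf.nonneg _)
    have h2 := hf.integral_eq_one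
    rw [integral_congr_ae h1] at h2
    simp at h2
  obtain ⟨y, hy0, hy⟩ := this
  rw [mem_interior]
  exact ⟨Ioo (-y) y, Ioo_subset_Icc_self.trans (hf.Icc_subset_pos hy), isOpen_Ioo,
    by simp [hy0]⟩

lemma Icc_subset_interior_pos (hf : IsSymmLogConcaveDensity f) {x : ℝ}
    (hx : x ∈ interior {x | 0 < f x}) : Icc 0 x ⊆ interior {x | 0 < f x} :=
  hf.convex_pos.interior.ordConnected.out hf.zero_mem_interior_pos hx

lemma pos_of_mem_interior {x : ℝ} (hx : x ∈ interior {y | 0 < f y}) : 0 < f x :=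
  (interior_subset hx : x ∈ {y | 0 < f y})

lemma continuousOn_log (hf : IsSymmLogConcaveDensity f) :
    ContinuousOn (fun x => Real.log (f x)) (interior {x | 0 < f x}) := by
  have := hf.convexOn_neg_log.continuousOn_interior.neg
  simpa only [Pi.neg_def, neg_neg] using this

lemma continuousOn (hf : IsSymmLogConcaveDensity f) :
    ContinuousOn f (interior {x | 0 < f x}) :=
  (Real.continuous_exp.comp_continuousOn hf.continuousOn_log).congr
    fun _ hx => (Real.exp_log (pos_of_mem_interior hx)).symm

end IsSymmLogConcaveDensity

/-! ### One-sided derivatives and tangent exponentials. -/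

/-- The slope to the right of the potential `-log f`. -/
noncomputable def potentialSlope (f : ℝ → ℝ) (x : ℝ) : ℝ :=
  derivWithin (fun x => -Real.log (f x)) (Ioi x) x

namespace IsSymmLogConcaveDensity

variable {f : ℝ → ℝ}

/-- A convex potential may have corners, but it has a right derivative at every interior point of
its domain. All monotonicity arguments below therefore use right derivatives. -/
lemma hasDerivWithinAt_log (hf : IsSymmLogConcaveDensity f) {x : ℝ}
    (hx : x ∈ interior {x | 0 < f x}) :
    HasDerivWithinAt (fun x => Real.log (f x)) (-potentialSlope f x) (Ici x) x := by
  have h := (hf.convexOn_neg_log.hasDerivWithinAt_rightDeriv_of_mem_interior hx).neg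
  rw [hasDerivWithinAt_Ioi_iff_Ici] at h
  simpa only [potentialSlope, Pi.neg_def, neg_neg] using h

lemma hasDerivWithinAt (hf : IsSymmLogConcaveDensity f) {x : ℝ}
    (hx : x ∈ interior {x | 0 < f x}) :
    HasDerivWithinAt f (-potentialSlope f x * f x) (Ici x) x := by
  have hpos : 0 < f x := pos_of_mem_interior hx
  have h := (hf.hasDerivWithinAt_log hx).exp
  rw [Real.exp_log hpos, mul_comm] at h
  refine h.congr_of_eventuallyEq ?_ (Real.exp_log hpos).symm
  filter_upwards [mem_nhdsWithin_of_mem_nhds (isOpen_interior.mem_nhds hx)] with y hy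
  exact (Real.exp_log (pos_of_mem_interior hy)).symm

/-- The tangent exponential at `x` dominates the density to the right of `x`. -/
lemma apply_le_mul_exp (hf : IsSymmLogConcaveDensity f) {x z : ℝ}
    (hx : x ∈ interior {x | 0 < f x}) (hxz : x < z) :
    f z ≤ f x * Real.exp (-potentialSlope f x * (z - x)) := by
  have hpos : 0 < f x := pos_of_mem_interior hx
  rcases (hf.nonneg z).eq_or_lt with h | h
  · rw [← h]; positivity
  have h1 := hf.convexOn_neg_log.rightDeriv_le_slope_of_mem_interior hx h hxz
  rw [slope_def_field, le_div_iff₀ (by linarith)] at h1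
  change potentialSlope f x * (z - x) ≤ _ at h1
  rw [← Real.exp_log h, ← Real.exp_log hpos, ← Real.exp_add]
  apply Real.exp_le_exp.2
  linarith

lemma potentialSlope_nonneg (hf : IsSymmLogConcaveDensity f) {x : ℝ} (hx0 : 0 ≤ x)
    (hx : x ∈ interior {x | 0 < f x}) : 0 ≤ potentialSlope f x := by
  have hpos : 0 < f x := pos_of_mem_interior hx
  have h : -potentialSlope f x * f x ≤ 0 := by
    refine le_of_tendsto ((hasDerivWithinAt_iff_tendsto_slope' (self_notMem_Ioi)).1
      (hf.hasDerivWithinAt hx).Ioi_of_Ici) ?_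
    filter_upwards [self_mem_nhdsWithin] with y hy
    have hy' : x < y := hy
    rw [slope_def_field]
    exact div_nonpos_of_nonpos_of_nonneg
      (sub_nonpos.2 (hf.antitoneOn hx0 (hx0.trans hy'.le) hy'.le)) (by linarith)
  nlinarith

/-- Integrate the tangent exponential at x over the tail. Equality holds for exponential tails. -/
lemma potentialSlope_mul_integral_le (hf : IsSymmLogConcaveDensity f) {x : ℝ} (hx0 : 0 ≤ x)
    (hx : x ∈ interior {x | 0 < f x}) :
    potentialSlope f x * ∫ z in Ioi x, f z ≤ f x := by
  have hpos : 0 < f x := pos_of_mem_interior hx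
  rcases (hf.potentialSlope_nonneg hx0 hx).eq_or_lt with h | h
  · rw [← h]; simpa using hpos.le
  set v := potentialSlope f x
  have hi : IntegrableOn (fun z => f x * Real.exp (-v * (z - x))) (Ioi x) := by
    have := (exp_neg_integrableOn_Ioi x h).const_mul (f x * Real.exp (v * x))
    refine IntegrableOn.congr_fun this (fun z _ => ?_) measurableSet_Ioi
    simp only [mul_assoc, ← Real.exp_add]
    congr 2; ring
  have h1 : ∫ z in Ioi x, f z ≤ ∫ z in Ioi x, f x * Real.exp (-v * (z - x)) :=
    setIntegral_mono_on hf.integrable.integrableOn hi measurableSet_Ioi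
      fun z hz => hf.apply_le_mul_exp hx hz
  have h2 : ∫ z in Ioi x, f x * Real.exp (-v * (z - x)) = f x / v := by
    have : ∀ z, f x * Real.exp (-v * (z - x)) = f x * Real.exp (v * x) * Real.exp (-v * z) := by
      intro z
      rw [mul_assoc, ← Real.exp_add]; congr 2; ring
    simp_rw [this]
    rw [integral_const_mul, integral_exp_mul_Ioi (by linarith)]
    rw [mul_assoc, mul_div_assoc', mul_neg, ← Real.exp_add]
    have : v * x + -v * x = 0 := by ring
    rw [this, Real.exp_zero]; field_simp
  rw [h2] at h1
  calc v * ∫ z in Ioi x, f z ≤ v * (f x / v) := by gcongr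
    _ = f x := by field_simp

/-- Integrals over the tails of the support become small. -/
lemma exists_seq_tail_tendsto (hf : IsSymmLogConcaveDensity f) :
    ∃ u : ℕ → ℝ, (∀ n, 0 ≤ u n ∧ u n ∈ interior {x | 0 < f x}) ∧
      ∀ h : ℝ → ℝ, Integrable h → (∀ x, f x = 0 → h x = 0) →
        Tendsto (fun n => ∫ z in Ioi (u n), h z) atTop (𝓝 0) := by
  set J := interior {x | 0 < f x} with hJ
  have hex : ∃ u : ℕ → ℝ, (∀ n, 0 ≤ u n ∧ u n ∈ J) ∧ ∀ z ∈ J, ∀ᶠ n in atTop, z ≤ u n := by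
    by_cases hb : BddAbove J
    · have hlub := isLUB_csSup ⟨0, hf.zero_mem_interior_pos⟩ hb
      -- An open set does not contain its supremum, so an increasing sequence tending to it
      -- eventually passes every point of J.
      have hnot : sSup J ∉ J := by
        intro hmem
        obtain ⟨e, he, hsub⟩ := Metric.isOpen_iff.1 (isOpen_interior : IsOpen J) _ hmem
        have : sSup J + e / 2 ∈ J := hsub (by
          rw [Metric.mem_ball, Real.dist_eq]; ring_nf; rw [abs_of_pos (by linarith)]; linarith)
        have := hlub.1 this
        linarith
      obtain ⟨u, hu, -, hlim, hmem⟩ := hlub.exists_seq_monotone_tendsto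
        ⟨0, hf.zero_mem_interior_pos⟩
      refine ⟨fun n => max 0 (u n), fun n => ⟨le_max_left _ _, ?_⟩, fun z hz => ?_⟩
      · rcases max_choice 0 (u n) with h | h
        · simp only [h]; exact hf.zero_mem_interior_pos
        · simp only [h]; exact hmem n
      · have hlt : z < sSup J := lt_of_le_of_ne (hlub.1 hz) (fun h => hnot (h ▸ hz))
        filter_upwards [hlim.eventually (lt_mem_nhds hlt)] with n hn
        exact hn.le.trans (le_max_right _ _)
    · refine ⟨fun n => n, fun n => ⟨by positivity, ?_⟩, fun z _ => ?_⟩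
      · rw [not_bddAbove_iff] at hb
        obtain ⟨y, hy, hny⟩ := hb n
        exact hf.Icc_subset_interior_pos hy ⟨by positivity, hny.le⟩
      · obtain ⟨N, hN⟩ := exists_nat_ge z
        filter_upwards [eventually_ge_atTop N] with n hn
        exact hN.trans (by exact_mod_cast hn)
  obtain ⟨u, hu, hev⟩ := hex
  refine ⟨u, hu, fun h hh hz => ?_⟩
  -- The density may jump at the ends of its support. These points form the frontier of a convex
  -- set, hence a null set, and can be ignored.
  have hnull : volume (frontier {x | 0 < f x}) = 0 := hf.convex_pos.addHaar_frontier volume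
  have key : Tendsto (fun n => ∫ z, (Ioi (u n)).indicator h z) atTop (𝓝 (∫ _ : ℝ, (0 : ℝ))) := by
    refine tendsto_integral_of_dominated_convergence (fun z => ‖h z‖)
      (fun n => (hh.indicator measurableSet_Ioi).aestronglyMeasurable) hh.norm
      (fun n => ae_of_all _ fun z => norm_indicator_le_norm_self _ _) ?_
    filter_upwards [compl_mem_ae_iff.2 hnull] with z hz'
    by_cases hzJ : z ∈ J
    · refine tendsto_const_nhds.congr' ?_
      filter_upwards [hev z hzJ] with n hn
      rw [indicator_of_notMem (by simpa using hn)]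
    · have : f z = 0 := by
        by_contra hne
        have hp : 0 < f z := lt_of_le_of_ne (hf.nonneg z) (Ne.symm hne)
        exact hz' ⟨subset_closure hp, hzJ⟩
      have h0 := hz z this
      refine tendsto_const_nhds.congr fun n => ?_
      by_cases hm : z ∈ Ioi (u n)
      · rw [indicator_of_mem hm, h0]
      · rw [indicator_of_notMem hm]
  simp only [integral_zero] at key
  refine key.congr fun n => ?_
  rw [integral_indicator measurableSet_Ioi]

end IsSymmLogConcaveDensity
-- Tail mass and tail entropy.
/-- The mass of the density `f` to the right of `x`. -/
noncomputable def tailMass (f : ℝ → ℝ) (x : ℝ) : ℝ := ∫ z in Ioi x, f z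

/-- The integral over `z > x` of `(log (f x) - log (f z)) * f z`. -/
noncomputable def tailEntropy (f : ℝ → ℝ) (x : ℝ) : ℝ :=
  Real.log (f x) * tailMass f x - ∫ z in Ioi x, Real.log (f z) * f z

namespace IsSymmLogConcaveDensity

variable {f : ℝ → ℝ}

/-- A nonincreasing quantity is bounded below by its limit at the right end of the support. Since f
need not be continuous there, the limit is replaced by a lower bound through tail integrals of `h`,
which tend to 0. -/
lemma nonneg_of_rightDeriv_nonpos (hf : IsSymmLogConcaveDensity f) {g g' h : ℝ → ℝ}
    (hc : ContinuousOn g (interior {x | 0 < f x}))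
    (hg : ∀ x ∈ interior {x | 0 < f x}, 0 ≤ x → HasDerivWithinAt g (g' x) (Ici x) x)
    (hg' : ∀ x ∈ interior {x | 0 < f x}, 0 ≤ x → g' x ≤ 0)
    (hh : Integrable h) (h0 : ∀ x, 0 ≤ h x) (hz : ∀ x, f x = 0 → h x = 0)
    (hle : ∀ x ∈ interior {x | 0 < f x}, 0 ≤ x → -(∫ z in Ioi x, h z) ≤ g x)
    {x : ℝ} (hx : x ∈ interior {x | 0 < f x}) (hx0 : 0 ≤ x) : 0 ≤ g x := by
  obtain ⟨u, hu, htail⟩ := hf.exists_seq_tail_tendsto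
  have hlim := (htail h hh hz).neg
  rw [neg_zero] at hlim
  refine le_of_tendsto hlim (Eventually.of_forall fun n => ?_)
  set y := max x (u n)
  have hxy : x ≤ y := le_max_left _ _
  have hy : y ∈ interior {x | 0 < f x} := by
    rcases max_choice x (u n) with h | h
    · rw [show y = x from h]; exact hx
    · rw [show y = u n from h]; exact (hu n).2
  have hsub : Icc x y ⊆ interior {x | 0 < f x} :=
    (Icc_subset_Icc_left hx0).trans (hf.Icc_subset_interior_pos hy)
  have h1 : g y ≤ g x := image_le_of_deriv_right_le_deriv_boundary (B := fun _ => g x)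
    (B' := fun _ => 0) (hc.mono hsub)
    (fun z hz => hg z (hsub (Ico_subset_Icc_self hz)) (hx0.trans hz.1)) le_rfl
    continuousOn_const (fun z _ => hasDerivWithinAt_const _ _ _)
    (fun z hz => hg' z (hsub (Ico_subset_Icc_self hz)) (hx0.trans hz.1)) ⟨hxy, le_rfl⟩
  have h2 : ∫ z in Ioi y, h z ≤ ∫ z in Ioi (u n), h z :=
    setIntegral_mono_set hh.integrableOn (ae_of_all _ h0)
      (Ioi_subset_Ioi (le_max_right _ _)).eventuallyLE
  have h3 := hle y hy (hx0.trans hxy)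
  linarith

lemma continuousAt (hf : IsSymmLogConcaveDensity f) {x : ℝ}
    (hx : x ∈ interior {x | 0 < f x}) : ContinuousAt f x :=
  hf.continuousOn.continuousAt (isOpen_interior.mem_nhds hx)

lemma continuousAt_log (hf : IsSymmLogConcaveDensity f) {x : ℝ}
    (hx : x ∈ interior {x | 0 < f x}) : ContinuousAt (fun x => Real.log (f x)) x :=
  hf.continuousOn_log.continuousAt (isOpen_interior.mem_nhds hx)

lemma hasDerivAt_tailMass (hf : IsSymmLogConcaveDensity f) {x : ℝ}
    (hx : x ∈ interior {x | 0 < f x}) : HasDerivAt (tailMass f) (-f x) x :=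
  hasDerivAt_integral_Ioi hf.integrable hf.measurable (hf.continuousAt hx)

lemma hasDerivAt_integral_log_mul (hf : IsSymmLogConcaveDensity f) {x : ℝ}
    (hx : x ∈ interior {x | 0 < f x}) :
    HasDerivAt (fun y => ∫ z in Ioi y, Real.log (f z) * f z) (-(Real.log (f x) * f x)) x := by
  have := hf.measurable
  exact hasDerivAt_integral_Ioi hf.integrable_log_mul (by fun_prop)
    ((hf.continuousAt_log hx).mul (hf.continuousAt hx))

lemma hasDerivWithinAt_tailEntropy (hf : IsSymmLogConcaveDensity f) {x : ℝ}
    (hx : x ∈ interior {x | 0 < f x}) :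
    HasDerivWithinAt (tailEntropy f) (-potentialSlope f x * tailMass f x) (Ici x) x := by
  have h := ((hf.hasDerivWithinAt_log hx).mul
    (hf.hasDerivAt_tailMass hx).hasDerivWithinAt).sub
    (hf.hasDerivAt_integral_log_mul hx).hasDerivWithinAt
  refine h.congr_deriv ?_
  ring

lemma continuousOn_tailMass (hf : IsSymmLogConcaveDensity f) :
    ContinuousOn (tailMass f) (interior {x | 0 < f x}) :=
  fun _ hx => (hf.hasDerivAt_tailMass hx).continuousAt.continuousWithinAt

lemma continuousOn_tailEntropy (hf : IsSymmLogConcaveDensity f) :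
    ContinuousOn (tailEntropy f) (interior {x | 0 < f x}) :=
  (hf.continuousOn_log.mul hf.continuousOn_tailMass).sub
    fun _ hx => (hf.hasDerivAt_integral_log_mul hx).continuousAt.continuousWithinAt

lemma tailMass_nonneg (hf : IsSymmLogConcaveDensity f) (x : ℝ) : 0 ≤ tailMass f x :=
  setIntegral_nonneg measurableSet_Ioi fun z _ => hf.nonneg z

lemma tailEntropy_eq (hf : IsSymmLogConcaveDensity f) (x : ℝ) :
    tailEntropy f x = ∫ z in Ioi x, (Real.log (f x) - Real.log (f z)) * f z := by
  simp_rw [sub_mul]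
  rw [integral_sub (hf.integrable.const_mul _).integrableOn hf.integrable_log_mul.integrableOn,
    integral_const_mul]
  rfl

lemma tailEntropy_nonneg (hf : IsSymmLogConcaveDensity f) {x : ℝ} (hx0 : 0 ≤ x) :
    0 ≤ tailEntropy f x := by
  rw [hf.tailEntropy_eq]
  refine setIntegral_nonneg measurableSet_Ioi fun z hz => ?_
  have hxz : x < z := hz
  rcases (hf.nonneg z).eq_or_lt with h | h
  · simp [← h]
  · have := Real.log_le_log h (hf.antitoneOn hx0 (hx0.trans hxz.le) hxz.le)
    exact mul_nonneg (by linarith) h.le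

/-- Replacing log f(x) by log f(0) makes the integrand independent of x, the form required of the
tail bound in `nonneg_of_rightDeriv_nonpos`. -/
lemma tailEntropy_le_integral (hf : IsSymmLogConcaveDensity f) {x : ℝ} (hx : 0 < f x) :
    tailEntropy f x ≤ ∫ z in Ioi x, (Real.log (f 0) - Real.log (f z)) * f z := by
  rw [hf.tailEntropy_eq]
  have hi : Integrable fun z => (Real.log (f x) - Real.log (f z)) * f z := by
    refine ((hf.integrable.const_mul (Real.log (f x))).sub hf.integrable_log_mul).congr
      (ae_of_all _ fun z => ?_)
    simp only [Pi.sub_apply]; ring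
  refine setIntegral_mono hi.integrableOn hf.integrable_log_sub_log_mul.integrableOn fun z => ?_
  have := Real.log_le_log hx (hf.apply_le_apply_zero x)
  exact mul_le_mul_of_nonneg_right (by linarith) (hf.nonneg z)

/-- The difference of the two sides has right derivative v * `tailMass f x` - f(x), with v the
potential slope, and this is nonpositive by the tangent exponential bound. Equality holds for
exponential tails. -/
lemma tailEntropy_le_tailMass (hf : IsSymmLogConcaveDensity f) {x : ℝ} (hx0 : 0 ≤ x)
    (hx : x ∈ interior {x | 0 < f x}) : tailEntropy f x ≤ tailMass f x := by
  have := hf.nonneg_of_rightDeriv_nonpos (g := fun x => tailMass f x - tailEntropy f x)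
    (g' := fun x => -f x - -potentialSlope f x * tailMass f x)
    (h := fun z => (Real.log (f 0) - Real.log (f z)) * f z)
    (hf.continuousOn_tailMass.sub hf.continuousOn_tailEntropy)
    (fun x hx _ => (hf.hasDerivAt_tailMass hx).hasDerivWithinAt.sub
      (hf.hasDerivWithinAt_tailEntropy hx))
    (fun x hx hx0 => by
      have := hf.potentialSlope_mul_integral_le hx0 hx
      rw [← tailMass] at this
      linarith)
    hf.integrable_log_sub_log_mul hf.log_sub_log_mul_nonneg
    (fun x h => by simp [h])
    (fun x hx hx0 => by
      have h1 := hf.tailMass_nonneg x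
      have h2 := hf.tailEntropy_le_integral (pos_of_mem_interior hx)
      linarith) hx hx0
  linarith

/-! ### The monotone functional behind the second moment bound. -/

/-- The cubic polynomial that controls the third moment of the level sets beyond `x`, in terms of
`x`, of `a = tailMass f x / f x` and of `c = tailEntropy f x / f x`. -/
noncomputable def levelPoly (x a c : ℝ) : ℝ :=
  (x + a) ^ 3 + 3 * (x + a) * c ^ 2 + 2 * c ^ 3 + (a - c) * c * (3 * (x + a) + c / 2 - a) - x ^ 3

lemma continuous_levelPoly : Continuous fun t : ℝ × ℝ × ℝ => levelPoly t.1 t.2.1 t.2.2 := by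
  unfold levelPoly
  fun_prop

lemma levelPoly_nonneg {x a c : ℝ} (hx : 0 ≤ x) (hc : 0 ≤ c) (hca : c ≤ a) :
    0 ≤ levelPoly x a c := by
  have ha : 0 ≤ a := hc.trans hca
  have h1 : 0 ≤ (a - c) * c * (3 * x + 2 * a + c / 2) :=
    mul_nonneg (mul_nonneg (by linarith) hc) (by positivity)
  have h2 : levelPoly x a c = 3 * x ^ 2 * a + 3 * x * a ^ 2 + a ^ 3 + 3 * (x + a) * c ^ 2 +
      2 * c ^ 3 + (a - c) * c * (3 * x + 2 * a + c / 2) := by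
    unfold levelPoly; ring
  rw [h2]
  positivity

/-- The derivative that shows the monotonicity of the functional below. -/
lemma hasDerivWithinAt_levelPoly (hf : IsSymmLogConcaveDensity f) {x : ℝ}
    (hx : x ∈ interior {x | 0 < f x}) {v a c : ℝ} (hv : v = potentialSlope f x)
    (ha : a = tailMass f x / f x) (hc : c = tailEntropy f x / f x) :
    HasDerivWithinAt (fun y => f y * levelPoly y (tailMass f y / f y) (tailEntropy f y / f y) -
        ∫ z in Ioi y, 3 * (z ^ 2 * f z))
      (-(f x * (3 * v * c ^ 2 * (a - c) + (1 - v * a) * c * (3 * (x + a) - 2 * a + 3 / 2 * c))))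
      (Ici x) x := by
  have hpos : 0 < f x := pos_of_mem_interior hx
  have hm := hf.measurable
  have hT : HasDerivWithinAt (fun y => ∫ z in Ioi y, 3 * (z ^ 2 * f z)) (-(3 * (x ^ 2 * f x)))
      (Ici x) x :=
    (hasDerivAt_integral_Ioi (hf.integrable_sq_mul.const_mul 3) (by fun_prop)
      (by have := hf.continuousAt hx; fun_prop)).hasDerivWithinAt
  have hF : HasDerivWithinAt f (-v * f x) (Ici x) x := hv ▸ hf.hasDerivWithinAt hx
  have hA : HasDerivWithinAt (fun y => tailMass f y / f y) (-1 + v * a) (Ici x) x := by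
    refine ((hf.hasDerivAt_tailMass hx).hasDerivWithinAt.div hF hpos.ne').congr_deriv ?_
    rw [ha]; field_simp; ring
  have hC : HasDerivWithinAt (fun y => tailEntropy f y / f y) (-v * (a - c)) (Ici x) x := by
    refine ((hf.hasDerivWithinAt_tailEntropy hx).div hF hpos.ne').congr_deriv ?_
    rw [ha, hc, ← hv]; field_simp; ring
  have hI : HasDerivWithinAt (fun y : ℝ => y) 1 (Ici x) x := hasDerivWithinAt_id _ _
  have hM := hI.add hA
  have hP := (((((hM.pow 3).add ((hM.const_mul 3).mul (hC.pow 2))).add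
    ((hC.pow 3).const_mul 2)).add (((hA.sub hC).mul hC).mul
      (((hM.const_mul 3).add (hC.div_const 2)).sub hA))).sub (hI.pow 3))
  refine ((hF.mul hP).sub hT).congr_deriv ?_
  simp only [Pi.add_apply, Pi.mul_apply, Pi.sub_apply, Pi.pow_apply, ← ha, ← hc]
  push_cast
  ring

/-- The second moment is bounded in terms of the maximum of the density and of the entropy. -/
lemma integral_Ioi_sq_mul_le (hf : IsSymmLogConcaveDensity f) :
    ∫ z in Ioi 0, 3 * (z ^ 2 * f z) ≤
      f 0 * levelPoly 0 (tailMass f 0 / f 0) (tailEntropy f 0 / f 0) := by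
  have bounds : ∀ x ∈ interior {x | 0 < f x}, 0 ≤ x → 0 < f x ∧ 0 ≤ tailEntropy f x / f x ∧
      tailEntropy f x / f x ≤ tailMass f x / f x := fun x hx hx0 => by
    have hpos : 0 < f x := pos_of_mem_interior hx
    exact ⟨hpos, div_nonneg (hf.tailEntropy_nonneg hx0) hpos.le,
      div_le_div_of_nonneg_right (hf.tailEntropy_le_tailMass hx0 hx) hpos.le⟩
  have hne : ∀ x ∈ interior {x | 0 < f x}, f x ≠ 0 := fun x hx => (pos_of_mem_interior hx).ne'
  have hm := hf.measurable
  have hint : Integrable fun z => 3 * (z ^ 2 * f z) := hf.integrable_sq_mul.const_mul 3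
  have hcont : ContinuousOn (fun y => f y * levelPoly y (tailMass f y / f y)
      (tailEntropy f y / f y) - ∫ z in Ioi y, 3 * (z ^ 2 * f z)) (interior {x | 0 < f x}) := by
    have hT : ContinuousOn (fun y => ∫ z in Ioi y, 3 * (z ^ 2 * f z)) (interior {x | 0 < f x}) :=
      fun x hx => (hasDerivAt_integral_Ioi hint (by fun_prop)
        (by have := hf.continuousAt hx; fun_prop)).continuousAt.continuousWithinAt
    have hA := hf.continuousOn_tailMass.div hf.continuousOn hne
    have hC := hf.continuousOn_tailEntropy.div hf.continuousOn hne
    exact (hf.continuousOn.mul (continuous_levelPoly.comp_continuousOn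
      (continuousOn_id.prodMk (hA.prodMk hC)))).sub hT
  have key := hf.nonneg_of_rightDeriv_nonpos (h := fun z => 3 * (z ^ 2 * f z)) hcont
    (fun x hx hx0 => hf.hasDerivWithinAt_levelPoly hx rfl rfl rfl)
    -- The derivative has the right sign because 0 ≤ c ≤ a, 0 ≤ v and v a ≤ 1; the last linear
    -- factor is 3x + a + 3c/2.
    (fun x hx hx0 => by
      obtain ⟨hpos, hc, hca⟩ := bounds x hx hx0
      have hv := hf.potentialSlope_nonneg hx0 hx
      have hva : potentialSlope f x * (tailMass f x / f x) ≤ 1 := by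
        rw [mul_div_assoc', div_le_one hpos]
        exact hf.potentialSlope_mul_integral_le hx0 hx
      have ha := hc.trans hca
      have h1 : 0 ≤ 3 * (x + tailMass f x / f x) - 2 * (tailMass f x / f x) +
        3 / 2 * (tailEntropy f x / f x) := by linarith
      refine neg_nonpos.2 (mul_nonneg hpos.le (add_nonneg ?_ ?_))
      · exact mul_nonneg (mul_nonneg (by positivity) (by positivity)) (by linarith)
      · exact mul_nonneg (mul_nonneg (by linarith) hc) h1)
    hint (fun x => by have := hf.nonneg x; positivity) (fun x h => by simp [h])
    (fun x hx hx0 => by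
      obtain ⟨hpos, hc, hca⟩ := bounds x hx hx0
      have := mul_nonneg hpos.le (levelPoly_nonneg hx0 hc hca)
      linarith) hf.zero_mem_interior_pos le_rfl
  linarith

/-! ### Uniform laws minimize Shannon entropy at given variance. -/

lemma integral_eq_two_mul_integral_Ioi (hf : IsSymmLogConcaveDensity f) (g : ℝ → ℝ → ℝ) :
    ∫ x, g |x| (f x) = 2 * ∫ x in Ioi 0, g x (f x) := by
  rw [← integral_comp_abs (f := fun x => g x (f x))]
  simp_rw [hf.apply_abs]

/-- The entropy of `f` above its minimal possible value `-log (f 0)`. -/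
noncomputable def _root_.SymmLogConcave.excessEntropy (f : ℝ → ℝ) : ℝ :=
  ∫ x, (Real.log (f 0) - Real.log (f x)) * f x

lemma tailMass_zero (hf : IsSymmLogConcaveDensity f) : tailMass f 0 = 1 / 2 := by
  have h := hf.integral_eq_two_mul_integral_Ioi (fun _ y => y)
  rw [hf.integral_eq_one] at h
  unfold tailMass
  linarith

lemma tailEntropy_zero (hf : IsSymmLogConcaveDensity f) :
    tailEntropy f 0 = excessEntropy f / 2 := by
  have h := hf.integral_eq_two_mul_integral_Ioi
    (fun _ y => (Real.log (f 0) - Real.log y) * y)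
  rw [hf.tailEntropy_eq, excessEntropy]
  linarith

lemma excessEntropy_nonneg (hf : IsSymmLogConcaveDensity f) : 0 ≤ excessEntropy f :=
  integral_nonneg hf.log_sub_log_mul_nonneg

lemma excessEntropy_le_one (hf : IsSymmLogConcaveDensity f) : excessEntropy f ≤ 1 := by
  have := hf.tailEntropy_le_tailMass le_rfl hf.zero_mem_interior_pos
  rw [hf.tailMass_zero, hf.tailEntropy_zero] at this
  linarith

lemma twelve_mul_variance_le (hf : IsSymmLogConcaveDensity f) :
    12 * (∫ x, x ^ 2 * f x) * f 0 ^ 2 ≤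
      1 + 2 * excessEntropy f + 3 / 2 * excessEntropy f ^ 2 + 3 / 2 * excessEntropy f ^ 3 := by
  have h := hf.integral_Ioi_sq_mul_le
  have h2 := hf.integral_eq_two_mul_integral_Ioi (fun x y => x ^ 2 * y)
  simp only [sq_abs] at h2
  have hpos := hf.apply_zero_pos
  rw [integral_const_mul, hf.tailMass_zero, hf.tailEntropy_zero] at h
  set e := excessEntropy f
  have h3 : f 0 * levelPoly 0 (1 / 2 / f 0) (e / 2 / f 0) * f 0 ^ 2 * 8 =
      1 + 2 * e + 3 / 2 * e ^ 2 + 3 / 2 * e ^ 3 := by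
    unfold levelPoly
    field_simp
    ring
  have h4 := mul_le_mul_of_nonneg_right h (show 0 ≤ f 0 ^ 2 * 8 by positivity)
  rw [← h3, h2]
  linarith

/-- The third-degree Taylor polynomial of exp(2e), a lower bound for e ≥ 0, exceeds the left side by
e²(1/2 - e/6). -/
lemma cubic_le_exp {e : ℝ} (h0 : 0 < e) (h1 : e ≤ 1) :
    1 + 2 * e + 3 / 2 * e ^ 2 + 3 / 2 * e ^ 3 < Real.exp (2 * e) := by
  have h := Real.sum_le_exp_of_nonneg (show 0 ≤ 2 * e by linarith) 4
  simp [Finset.sum_range_succ, Nat.factorial] at h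
  have : 0 < e ^ 2 * (1 / 2 - e / 6) := by
    apply mul_pos (by positivity); linarith
  nlinarith

/-- Among symmetric log-concave distributions with given variance, uniform distributions have
minimal entropy. -/
lemma twelve_mul_variance_le_exp (hf : IsSymmLogConcaveDensity f) :
    12 * (∫ x, x ^ 2 * f x) * f 0 ^ 2 ≤ Real.exp (2 * excessEntropy f) := by
  rcases hf.excessEntropy_nonneg.eq_or_lt with h | h
  · have := hf.twelve_mul_variance_le
    rw [← h] at this ⊢
    simpa using this
  · exact hf.twelve_mul_variance_le.trans (cubic_le_exp h hf.excessEntropy_le_one).le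

lemma excessEntropy_eq_zero_of_eq (hf : IsSymmLogConcaveDensity f)
    (h : 12 * (∫ x, x ^ 2 * f x) * f 0 ^ 2 = Real.exp (2 * excessEntropy f)) :
    excessEntropy f = 0 := by
  by_contra hne
  have h0 := lt_of_le_of_ne hf.excessEntropy_nonneg (Ne.symm hne)
  have := cubic_le_exp h0 hf.excessEntropy_le_one
  linarith [hf.twelve_mul_variance_le]

end IsSymmLogConcaveDensity
-- Comparison of the p-th moment with the variance.
namespace IsSymmLogConcaveDensity

variable {f : ℝ → ℝ}

lemma moment_pos (hf : IsSymmLogConcaveDensity f) {r : ℝ} (hr : 0 ≤ r) :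
    0 < ∫ x, |x| ^ r * f x := by
  have hnn : ∀ x, 0 ≤ |x| ^ r * f x := fun x => mul_nonneg (by positivity) (hf.nonneg x)
  refine lt_of_le_of_ne (integral_nonneg hnn) fun h => ?_
  have h1 := (integral_eq_zero_iff_of_nonneg hnn (hf.integrable_abs_rpow_mul hr)).1 h.symm
  have h2 : f =ᵐ[volume] 0 := by
    filter_upwards [h1, compl_mem_ae_iff.2 (measure_singleton (0 : ℝ) (μ := volume))] with x hx hx0
    have hx0' : x ≠ 0 := hx0
    have : 0 < |x| ^ r := by positivity
    simpa [this.ne'] using hx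
  have h3 := hf.integral_eq_one
  rw [integral_congr_ae h2] at h3
  simp at h3

/-- The concave function t^(p/2) lies below its tangent at t = c; here t = x². This is Bernoulli's
inequality for an exponent at most 1. -/
lemma rpow_le_tangent {p c x : ℝ} (hp0 : 0 < p) (hp2 : p ≤ 2) (hc : 0 < c) (hx : 0 ≤ x) :
    x ^ p ≤ (1 - p / 2) * c ^ (p / 2) + p / 2 * (c ^ (p / 2) / c) * x ^ 2 := by
  have h := _root_.rpow_one_add_le_one_add_mul_self (s := x ^ 2 / c - 1) (p := p / 2)
    (by have : 0 ≤ x ^ 2 / c := by positivity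
        linarith) (by linarith) (by linarith)
  rw [add_sub_cancel, Real.div_rpow (by positivity) hc.le, ← Real.rpow_natCast x 2,
    ← Real.rpow_mul hx] at h
  have hK : 0 < c ^ (p / 2) := by positivity
  rw [div_le_iff₀ hK] at h
  have e : ((2 : ℕ) : ℝ) * (p / 2) = p := by push_cast; ring
  rw [e, Real.rpow_natCast] at h
  refine h.trans (le_of_eq ?_)
  field_simp
  ring

/-- Comparison of moments for symmetric log-concave densities. -/
lemma moment_le_rpow_variance (hf : IsSymmLogConcaveDensity f) {p : ℝ} (hp0 : 0 < p)
    (hp2 : p ≤ 2) :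
    (p + 1) * ∫ x, |x| ^ p * f x ≤ (3 * ∫ x, x ^ 2 * f x) ^ (p / 2) := by
  set c := 3 * ∫ x, x ^ 2 * f x with hcdef
  have hc : 0 < c := by
    have := hf.moment_pos (r := 2) (by norm_num)
    simp only [Real.rpow_ofNat, sq_abs] at this
    positivity
  set K := c ^ (p / 2) with hK
  set A := (1 - p / 2) * K with hA
  set B := p / 2 * (K / c) with hB
  have hm := hf.measurable
  -- On x ≥ 0 this is θ' f, where θ, set below, is x times the nonpositive error x^p - A - B x² of
  -- the tangent at c. Integration by parts turns ∫ θ' f over x > 0 into ∫ θ v f with slope v ≥ 0,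
  -- up to a nonpositive boundary term, so the integral is at most 0.
  set w : ℝ → ℝ := fun x => ((p + 1) * |x| ^ p - A - B * (3 * x ^ 2)) * f x with hw
  have hwi : Integrable w := by
    refine ((((hf.integrable_abs_rpow_mul hp0.le).const_mul (p + 1)).sub
      (hf.integrable.const_mul A)).sub (hf.integrable_sq_mul.const_mul (B * 3))).congr
      (ae_of_all _ fun x => ?_)
    simp only [Pi.sub_apply, hw]
    ring
  have hwm : Measurable w := by fun_prop
  set θ : ℝ → ℝ := fun x => x ^ (p + 1) - A * x - B * x ^ 3 with hθ
  have hθ0 : ∀ x, 0 ≤ x → θ x ≤ 0 := by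
    intro x hx
    have h := rpow_le_tangent hp0 hp2 hc hx
    have e : θ x = (x ^ p - (A + B * x ^ 2)) * x := by
      simp only [hθ]
      rw [Real.rpow_add_one' hx (by linarith)]
      ring
    rw [e]
    have h' : x ^ p ≤ A + B * x ^ 2 := h
    exact mul_nonpos_of_nonpos_of_nonneg (by linarith) hx
  have hcw : ∀ x ∈ interior {x | 0 < f x}, ContinuousAt w x := by
    intro x hx
    have h1 := hf.continuousAt hx
    have h2 : ContinuousAt (fun x : ℝ => |x| ^ p) x :=
      (continuous_abs.rpow_const fun _ => Or.inr hp0.le).continuousAt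
    simp only [hw]
    fun_prop
  have hθc : Continuous θ := by
    have : Continuous fun x : ℝ => x ^ (p + 1) :=
      Real.continuous_rpow_const (by linarith)
    simp only [hθ]
    fun_prop
  have key := hf.nonneg_of_rightDeriv_nonpos
    (g := fun x => -(∫ z in Ioi x, w z) - f x * θ x)
    (g' := fun x => potentialSlope f x * f x * θ x) (h := fun z => |w z|)
    (ContinuousOn.sub (fun x hx => (hasDerivAt_integral_Ioi hwi hwm
      (hcw x hx)).neg.continuousAt.continuousWithinAt) (hf.continuousOn.mul hθc.continuousOn))
    (fun x hx hx0 => by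
      have h1 : HasDerivAt θ ((p + 1) * x ^ p - A - B * (3 * x ^ 2)) x := by
        have h := ((Real.hasDerivAt_rpow_const (x := x) (p := p + 1)
          (Or.inr (by linarith))).sub ((hasDerivAt_id x).const_mul A)).sub
          ((hasDerivAt_pow 3 x).const_mul B)
        refine h.congr_deriv ?_
        simp
      refine (((hasDerivAt_integral_Ioi hwi hwm (hcw x hx)).neg.hasDerivWithinAt).sub
        ((hf.hasDerivWithinAt hx).mul h1.hasDerivWithinAt)).congr_deriv ?_
      simp only [hw, abs_of_nonneg hx0]
      ring)
    (fun x hx hx0 => mul_nonpos_of_nonneg_of_nonpos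
      (mul_nonneg (hf.potentialSlope_nonneg hx0 hx) (hf.nonneg x)) (hθ0 x hx0))
    hwi.abs (fun _ => abs_nonneg _) (fun x hx => by simp [hw, hx])
    (fun x hx hx0 => by
      have h1 := mul_nonpos_of_nonneg_of_nonpos (hf.nonneg x) (hθ0 x hx0)
      have h2 : ∫ z in Ioi x, w z ≤ ∫ z in Ioi x, |w z| :=
        setIntegral_mono hwi.integrableOn hwi.abs.integrableOn fun z => le_abs_self _
      linarith)
    hf.zero_mem_interior_pos le_rfl
  have hθz : θ 0 = 0 := by
    simp only [hθ]
    rw [Real.zero_rpow (by linarith)]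
    simp
  simp only [hθz, mul_zero, sub_zero] at key
  have h1 : ∫ x, w x = 2 * ∫ x in Ioi 0, w x := by
    rw [← integral_comp_abs (f := w)]
    refine integral_congr_ae (ae_of_all _ fun x => ?_)
    simp only [hw, hf.apply_abs, abs_abs, sq_abs]
  have h2 : ∫ x, w x = (p + 1) * (∫ x, |x| ^ p * f x) - A - B * c := by
    have e : w = fun x => (p + 1) * (|x| ^ p * f x) - A * f x - B * 3 * (x ^ 2 * f x) := by
      funext x; simp only [hw]; ring
    have i1 : Integrable fun x => (p + 1) * (|x| ^ p * f x) - A * f x :=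
      ((hf.integrable_abs_rpow_mul hp0.le).const_mul (p + 1)).sub (hf.integrable.const_mul A)
    rw [e, integral_sub i1 (hf.integrable_sq_mul.const_mul (B * 3)),
      integral_sub ((hf.integrable_abs_rpow_mul hp0.le).const_mul (p + 1))
      (hf.integrable.const_mul A), integral_const_mul, integral_const_mul, integral_const_mul,
      hf.integral_eq_one, hcdef]
    ring
  -- The tangent line takes the value c^(p/2) at its point of contact c, which was chosen as 3 E X².
  have h3 : A + B * c = K := by
    simp only [hA, hB]; field_simp; ring
  linarith

/-! ### Rényi entropy bound: assembling the chain. -/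

/-- Jensen's inequality: Rényi entropies of order less than one dominate the Shannon entropy. -/
lemma rpow_mul_exp_le_integral_rpow (hf : IsSymmLogConcaveDensity f) {q : ℝ} (hq0 : 0 < q) :
    f 0 ^ (q - 1) * Real.exp ((1 - q) * excessEntropy f) ≤ ∫ x, f x ^ q := by
  have h0 := hf.apply_zero_pos
  set e := excessEntropy f with he
  set D := f 0 ^ (q - 1) * Real.exp ((1 - q) * e) with hD
  have hi : Integrable fun x => D * ((1 - (1 - q) * e) * f x +
      (1 - q) * ((Real.log (f 0) - Real.log (f x)) * f x)) :=
    ((hf.integrable.const_mul _).add (hf.integrable_log_sub_log_mul.const_mul _)).const_mul _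
  have h1 : ∫ x, D * ((1 - (1 - q) * e) * f x +
      (1 - q) * ((Real.log (f 0) - Real.log (f x)) * f x)) = D := by
    rw [integral_const_mul, integral_add (hf.integrable.const_mul _)
      (hf.integrable_log_sub_log_mul.const_mul _), integral_const_mul, integral_const_mul,
      hf.integral_eq_one, ← excessEntropy, ← he]
    ring
  rw [← h1]
  refine integral_mono hi (hf.integrable_rpow hq0) fun x => ?_
  rcases (hf.nonneg x).eq_or_lt with h | h
  · simp [← h, Real.zero_rpow hq0.ne']
  have h2 : f x ^ q = D * (Real.exp ((1 - q) * (Real.log (f 0) - Real.log (f x) - e)) * f x) := by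
    have : f x ^ q = f x ^ (q - 1) * f x := by
      rw [← Real.rpow_add_one h.ne']; congr 1; ring
    rw [this, hD, Real.rpow_def_of_pos h, Real.rpow_def_of_pos h0, ← mul_assoc, ← Real.exp_add,
      ← Real.exp_add]
    congr 2
    ring
  change _ ≤ f x ^ q
  rw [h2]
  -- The tangent of exp is taken at the mean: log f(0) - log f has mean e under f, so the linear
  -- term integrates to zero.
  have h3 := Real.add_one_le_exp ((1 - q) * (Real.log (f 0) - Real.log (f x) - e))
  have hDpos : 0 < D := by positivity
  refine mul_le_mul_of_nonneg_left ?_ hDpos.le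
  refine le_trans (le_of_eq ?_) (mul_le_mul_of_nonneg_right h3 h.le)
  ring

lemma exp_div_le_rpow (hf : IsSymmLogConcaveDensity f) {q : ℝ} (hq0 : 0 < q) (hq1 : q < 1) :
    Real.exp (excessEntropy f) / f 0 ≤ (∫ x, f x ^ q) ^ (1 / (1 - q)) := by
  have h0 := hf.apply_zero_pos
  have hq : 0 < 1 - q := by linarith
  have h := Real.rpow_le_rpow (by positivity) (hf.rpow_mul_exp_le_integral_rpow hq0)
    (show 0 ≤ 1 / (1 - q) by positivity)
  refine le_trans (le_of_eq ?_) h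
  rw [Real.mul_rpow (by positivity) (by positivity), ← Real.rpow_mul h0.le, ← Real.exp_mul]
  have e1 : (q - 1) * (1 / (1 - q)) = -1 := by field_simp; ring
  have e2 : (1 - q) * excessEntropy f * (1 / (1 - q)) = excessEntropy f := by field_simp
  rw [e1, e2, Real.rpow_neg_one]
  ring

lemma two_mul_sqrt_le (hf : IsSymmLogConcaveDensity f) :
    2 * (3 * ∫ x, x ^ 2 * f x) ^ (1 / 2 : ℝ) ≤ Real.exp (excessEntropy f) / f 0 := by
  have h0 := hf.apply_zero_pos
  have hm : 0 ≤ ∫ x, x ^ 2 * f x :=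
    integral_nonneg fun x => mul_nonneg (sq_nonneg x) (hf.nonneg x)
  rw [← Real.sqrt_eq_rpow]
  refine le_of_sq_le_sq ?_ (by positivity)
  rw [mul_pow, Real.sq_sqrt (by positivity), div_pow, le_div_iff₀ (by positivity),
    ← Real.exp_nat_mul]
  have := hf.twelve_mul_variance_le_exp
  push_cast
  linarith

lemma two_mul_moment_le_sqrt (hf : IsSymmLogConcaveDensity f) {p : ℝ} (hp0 : 0 < p)
    (hp2 : p ≤ 2) :
    2 * ((p + 1) * ∫ x, |x| ^ p * f x) ^ (1 / p) ≤ 2 * (3 * ∫ x, x ^ 2 * f x) ^ (1 / 2 : ℝ) := by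
  have hm : 0 ≤ ∫ x, x ^ 2 * f x :=
    integral_nonneg fun x => mul_nonneg (sq_nonneg x) (hf.nonneg x)
  have hmp := hf.moment_pos hp0.le
  have h := Real.rpow_le_rpow (by positivity) (hf.moment_le_rpow_variance hp0 hp2)
    (show 0 ≤ 1 / p by positivity)
  rw [← Real.rpow_mul (by positivity)] at h
  have e : p / 2 * (1 / p) = 1 / 2 := by field_simp
  rw [e] at h
  linarith

/-- Among symmetric log-concave distributions with given `p`-th moment, uniform distributions have
minimal Rényi entropy. -/
lemma two_mul_moment_le_rpow (hf : IsSymmLogConcaveDensity f) {p q : ℝ} (hp0 : 0 < p)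
    (hp2 : p ≤ 2) (hq0 : 0 < q) (hq1 : q < 1) :
    2 * ((p + 1) * ∫ x, |x| ^ p * f x) ^ (1 / p) ≤ (∫ x, f x ^ q) ^ (1 / (1 - q)) :=
  (hf.two_mul_moment_le_sqrt hp0 hp2).trans (hf.two_mul_sqrt_le.trans (hf.exp_div_le_rpow hq0 hq1))

/-! ### The equality case. -/

/-- The integrand of the excess entropy is nonnegative, so it vanishes almost everywhere and f
equals f(0) almost everywhere on its support. Total mass 1 fixes the length of the support, and
convexity with symmetry fixes its position. -/
lemma ae_eq_indicator_of_excessEntropy_eq_zero (hf : IsSymmLogConcaveDensity f)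
    (h : excessEntropy f = 0) :
    ∃ a : ℝ, 0 < a ∧ f =ᵐ[volume] (Icc (-a) a).indicator fun _ => 1 / (2 * a) := by
  have h0 := hf.apply_zero_pos
  have h1 := (integral_eq_zero_iff_of_nonneg hf.log_sub_log_mul_nonneg
    hf.integrable_log_sub_log_mul).1 h
  have hSm : MeasurableSet {x | 0 < f x} := measurableSet_lt measurable_const hf.measurable
  have h2 : f =ᵐ[volume] {x | 0 < f x}.indicator fun _ => f 0 := by
    filter_upwards [h1] with x hx
    rcases (hf.nonneg x).eq_or_lt with hz | hz
    · rw [indicator_of_notMem (by simp [← hz]), hz]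
    · rw [indicator_of_mem (by exact hz)]
      have h3 : Real.log (f 0) - Real.log (f x) = 0 := by
        simpa [hz.ne'] using hx
      exact Real.log_injOn_pos hz h0 (by linarith)
  set a := 1 / (2 * f 0) with ha
  have ha0 : 0 < a := by positivity
  have e : 1 / (2 * a) = f 0 := by rw [ha]; field_simp
  have hvol : volume {x | 0 < f x} = ENNReal.ofReal (2 * a) := by
    have h3 := hf.lintegral_eq_one
    have h4 : ∫⁻ x, ENNReal.ofReal (f x) =
        ∫⁻ x, {x | 0 < f x}.indicator (fun _ => ENNReal.ofReal (f 0)) x := by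
      refine lintegral_congr_ae ?_
      filter_upwards [h2] with x hx
      rw [hx]
      by_cases hm : x ∈ {x | 0 < f x}
      · rw [indicator_of_mem hm, indicator_of_mem hm]
      · rw [indicator_of_notMem hm, indicator_of_notMem hm, ENNReal.ofReal_zero]
    rw [h4, lintegral_indicator_const hSm] at h3
    have h5 := ENNReal.eq_inv_of_mul_eq_one_left (mul_comm _ _ |>.trans h3)
    rw [h5, ← ENNReal.ofReal_inv_of_pos h0, ha]
    congr 1; field_simp
  have hsub : {x | 0 < f x} ⊆ Icc (-a) a := by
    intro x hx
    refine abs_le.1 ?_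
    by_contra hlt
    rw [not_le] at hlt
    have hx' : 0 < f |x| := by rw [hf.apply_abs]; exact hx
    -- A point of the support with |x| > a would put [-|x|, |x|], of length greater than 2a, inside
    -- a set of measure 2a.
    have h3 := measure_mono (μ := volume) (hf.Icc_subset_pos hx')
    rw [hvol, Real.volume_Icc, ENNReal.ofReal_le_ofReal_iff (by positivity)] at h3
    linarith
  have heq : ({x | 0 < f x} : Set ℝ) =ᵐ[volume] Icc (-a) a := by
    refine ae_eq_of_subset_of_measure_ge hsub ?_ hSm.nullMeasurableSet (by simp)
    rw [hvol, Real.volume_Icc]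
    apply ENNReal.ofReal_le_ofReal
    linarith
  refine ⟨a, ha0, ?_⟩
  rw [e]
  exact h2.trans (indicator_ae_eq_of_ae_eq_set heq)

lemma moment_of_ae_eq_indicator {a p : ℝ} (ha : 0 < a) (hp : 0 < p)
    (h : f =ᵐ[volume] (Icc (-a) a).indicator fun _ => 1 / (2 * a)) :
    (p + 1) * ∫ x, |x| ^ p * f x = a ^ p := by
  have h1 : ∫ x, |x| ^ p * f x = ∫ x in Icc (-a) a, |x| ^ p * (1 / (2 * a)) := by
    rw [← integral_indicator measurableSet_Icc]
    refine integral_congr_ae ?_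
    filter_upwards [h] with x hx
    rw [hx]
    by_cases hm : x ∈ Icc (-a) a
    · rw [indicator_of_mem hm, indicator_of_mem hm]
    · rw [indicator_of_notMem hm, indicator_of_notMem hm, mul_zero]
  have h2 : ∫ x in Icc (-a) a, |x| ^ p * (1 / (2 * a)) =
      2 * ∫ x in Ioc 0 a, x ^ p * (1 / (2 * a)) := by
    have h3 := integral_comp_abs
      (f := (Icc (-a) a).indicator fun x : ℝ => x ^ p * (1 / (2 * a)))
    have h4 : ∫ x, (Icc (-a) a).indicator (fun x : ℝ => x ^ p * (1 / (2 * a))) |x| =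
        ∫ x in Icc (-a) a, |x| ^ p * (1 / (2 * a)) := by
      rw [← integral_indicator measurableSet_Icc]
      refine integral_congr_ae (ae_of_all _ fun x => ?_)
      by_cases hm : x ∈ Icc (-a) a
      · have : |x| ∈ Icc (-a) a := ⟨by linarith [abs_nonneg x], abs_le.2 hm⟩
        simp only [indicator_of_mem hm, indicator_of_mem this]
      · have : |x| ∉ Icc (-a) a := fun h => hm (abs_le.1 h.2)
        simp only [indicator_of_notMem hm, indicator_of_notMem this]
    have h5 : Ioi (0 : ℝ) ∩ Icc (-a) a = Ioc 0 a := by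
      ext x
      simp only [mem_inter_iff, mem_Ioi, mem_Icc, mem_Ioc]
      constructor
      · rintro ⟨h1, h2, h3⟩; exact ⟨h1, h3⟩
      · rintro ⟨h1, h2⟩; exact ⟨h1, by linarith, h2⟩
    rw [← h4, h3, setIntegral_indicator measurableSet_Icc, h5]
  rw [h1, h2, ← intervalIntegral.integral_of_le ha.le, intervalIntegral.integral_mul_const,
    integral_rpow (Or.inl (by linarith)), Real.zero_rpow (by linarith),
    Real.rpow_add_one ha.ne']
  field_simp
  ring

lemma integral_rpow_of_ae_eq_indicator {a q : ℝ} (ha : 0 < a) (hq : 0 < q)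
    (h : f =ᵐ[volume] (Icc (-a) a).indicator fun _ => 1 / (2 * a)) :
    ∫ x, f x ^ q = (2 * a) ^ (1 - q) := by
  have h1 : ∫ x, f x ^ q = ∫ x in Icc (-a) a, (1 / (2 * a)) ^ q := by
    rw [← integral_indicator measurableSet_Icc]
    refine integral_congr_ae ?_
    filter_upwards [h] with x hx
    rw [hx]
    by_cases hm : x ∈ Icc (-a) a
    · rw [indicator_of_mem hm, indicator_of_mem hm]
    · rw [indicator_of_notMem hm, indicator_of_notMem hm, Real.zero_rpow hq.ne']
  rw [h1, setIntegral_const, Real.volume_real_Icc_of_le (by linarith), smul_eq_mul, one_div,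
    Real.inv_rpow (by positivity), Real.rpow_sub (by positivity), Real.rpow_one]
  ring

/-- Equality of the ends forces equality in every link of the chain. The link between variance and
Shannon entropy alone already forces zero excess entropy. -/
lemma two_mul_moment_eq_rpow_iff (hf : IsSymmLogConcaveDensity f) {p q : ℝ} (hp0 : 0 < p)
    (hp2 : p ≤ 2) (hq0 : 0 < q) (hq1 : q < 1) :
    2 * ((p + 1) * ∫ x, |x| ^ p * f x) ^ (1 / p) = (∫ x, f x ^ q) ^ (1 / (1 - q)) ↔
      ∃ a : ℝ, 0 < a ∧ f =ᵐ[volume] (Icc (-a) a).indicator fun _ => 1 / (2 * a) := by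
  constructor
  · intro h
    apply hf.ae_eq_indicator_of_excessEntropy_eq_zero
    apply hf.excessEntropy_eq_zero_of_eq
    have h0 := hf.apply_zero_pos
    have h1 := hf.two_mul_moment_le_sqrt hp0 hp2
    have h2 := hf.two_mul_sqrt_le
    have h3 := hf.exp_div_le_rpow hq0 hq1
    have hm : 0 ≤ ∫ x, x ^ 2 * f x :=
      integral_nonneg fun x => mul_nonneg (sq_nonneg x) (hf.nonneg x)
    have h4 : 2 * (3 * ∫ x, x ^ 2 * f x) ^ (1 / 2 : ℝ) = Real.exp (excessEntropy f) / f 0 := by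
      linarith
    rw [← Real.sqrt_eq_rpow, eq_div_iff h0.ne'] at h4
    have h5 := congrArg (fun t => t ^ 2) h4
    simp only [mul_pow] at h5
    rw [Real.sq_sqrt (by positivity), ← Real.exp_nat_mul] at h5
    push_cast at h5
    linarith
  · rintro ⟨a, ha, h⟩
    rw [moment_of_ae_eq_indicator ha hp0 h, integral_rpow_of_ae_eq_indicator ha hq0 h,
      ← Real.rpow_mul ha.le, ← Real.rpow_mul (by positivity), mul_one_div_cancel hp0.ne',
      mul_one_div_cancel (by linarith), Real.rpow_one, Real.rpow_one]

end IsSymmLogConcaveDensity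
-- Gamma and beta integrals.
lemma lintegral_rpow_mul_exp_neg {a r : ℝ} (ha : 0 < a) (hr : 0 < r) :
    ∫⁻ t in Ioi (0 : ℝ), ENNReal.ofReal (t ^ (a - 1) * Real.exp (-(r * t))) =
      ENNReal.ofReal ((1 / r) ^ a * Real.Gamma a) := by
  rw [← Real.integral_rpow_mul_exp_neg_mul_Ioi ha hr, ofReal_integral_eq_lintegral_ofReal]
  · have := integrableOn_rpow_mul_exp_neg_mul_rpow (p := 1) (s := a - 1) (b := r) (by linarith)
      one_pos hr
    simpa [IntegrableOn] using this
  · filter_upwards [ae_restrict_mem measurableSet_Ioi] with t ht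
    have : (0 : ℝ) < t := ht
    positivity

lemma lintegral_rpow_mul_exp_neg_mul_rpow {p k b : ℝ} (hp : 0 < p) (hk : -1 < k) (hb : 0 < b) :
    ∫⁻ x in Ioi (0 : ℝ), ENNReal.ofReal (x ^ k * Real.exp (-b * x ^ p)) =
      ENNReal.ofReal (b ^ (-(k + 1) / p) * (1 / p) * Real.Gamma ((k + 1) / p)) := by
  rw [← integral_rpow_mul_exp_neg_mul_rpow hp hk hb, ofReal_integral_eq_lintegral_ofReal]
  · exact integrableOn_rpow_mul_exp_neg_mul_rpow hk hp hb
  · filter_upwards [ae_restrict_mem measurableSet_Ioi] with t ht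
    have : (0 : ℝ) < t := ht
    positivity

/-- A form of Euler's beta integral. -/
lemma lintegral_rpow_mul_one_add_rpow {p k c m : ℝ} (hp : 0 < p) (hk : -1 < k) (hc : 0 < c)
    (hm : (k + 1) / p < m) :
    ∫⁻ x in Ioi (0 : ℝ), ENNReal.ofReal (x ^ k * (1 + c * x ^ p) ^ (-m)) =
      ENNReal.ofReal (c ^ (-(k + 1) / p) * (1 / p) * Real.Gamma ((k + 1) / p) *
        Real.Gamma (m - (k + 1) / p) / Real.Gamma m) := by
  have hs : 0 < (k + 1) / p := div_pos (by linarith) hp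
  have hm0 : 0 < m := hs.trans hm
  have hG : 0 < Real.Gamma m := Real.Gamma_pos_of_pos hm0
  have hGs : 0 < Real.Gamma ((k + 1) / p) := Real.Gamma_pos_of_pos hs
  have hGd : 0 < Real.Gamma (m - (k + 1) / p) := Real.Gamma_pos_of_pos (by linarith)
  -- The negative power is written as a Gamma integral in t. After Tonelli, the integral in x is
  -- again of Gamma type, and so is the remaining one in t. Working with `∫⁻` avoids proving
  -- integrability beforehand.
  have h1 : ∀ x ∈ Ioi (0 : ℝ), ENNReal.ofReal (x ^ k * (1 + c * x ^ p) ^ (-m)) =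
      ENNReal.ofReal (1 / Real.Gamma m) * ∫⁻ t in Ioi (0 : ℝ),
        ENNReal.ofReal (x ^ k * (t ^ (m - 1) * Real.exp (-((1 + c * x ^ p) * t)))) := by
    intro x hx
    have hx0 : (0 : ℝ) < x := hx
    have hb : 0 < 1 + c * x ^ p := by positivity
    simp_rw [ENNReal.ofReal_mul (Real.rpow_nonneg hx0.le k)]
    rw [lintegral_const_mul' _ _ ENNReal.ofReal_ne_top, lintegral_rpow_mul_exp_neg hm0 hb,
      ← ENNReal.ofReal_mul (by positivity), ← ENNReal.ofReal_mul (by positivity),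
      ← ENNReal.ofReal_mul (by positivity)]
    congr 1
    rw [one_div (1 + c * x ^ p), Real.inv_rpow hb.le, Real.rpow_neg hb.le]
    field_simp
  rw [setLIntegral_congr_fun measurableSet_Ioi h1,
    lintegral_const_mul' _ _ ENNReal.ofReal_ne_top,
    lintegral_lintegral_swap (by
      apply Measurable.aemeasurable
      unfold Function.uncurry
      fun_prop)]
  have h2 : ∀ t ∈ Ioi (0 : ℝ), ∫⁻ x in Ioi (0 : ℝ),
        ENNReal.ofReal (x ^ k * (t ^ (m - 1) * Real.exp (-((1 + c * x ^ p) * t)))) =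
      ENNReal.ofReal (c ^ (-(k + 1) / p) * (1 / p) * Real.Gamma ((k + 1) / p)) *
        ENNReal.ofReal (t ^ (m - (k + 1) / p - 1) * Real.exp (-(1 * t))) := by
    intro t ht
    have ht0 : (0 : ℝ) < t := ht
    have e : ∀ x : ℝ, ENNReal.ofReal (x ^ k * (t ^ (m - 1) * Real.exp (-((1 + c * x ^ p) * t)))) =
        ENNReal.ofReal (t ^ (m - 1) * Real.exp (-t)) *
          ENNReal.ofReal (x ^ k * Real.exp (-(c * t) * x ^ p)) := by
      intro x
      rw [← ENNReal.ofReal_mul (by positivity)]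
      congr 1
      have : -((1 + c * x ^ p) * t) = -t + -(c * t) * x ^ p := by ring
      rw [this, Real.exp_add]
      ring
    simp_rw [e]
    rw [lintegral_const_mul' _ _ ENNReal.ofReal_ne_top,
      lintegral_rpow_mul_exp_neg_mul_rpow hp hk (by positivity),
      ← ENNReal.ofReal_mul (by positivity), ← ENNReal.ofReal_mul (by positivity)]
    congr 1
    have e2 : m - (k + 1) / p - 1 = (m - 1) + -(k + 1) / p := by ring
    rw [Real.mul_rpow hc.le ht0.le, e2, Real.rpow_add ht0, one_mul]
    ring
  rw [setLIntegral_congr_fun measurableSet_Ioi h2,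
    lintegral_const_mul' _ _ ENNReal.ofReal_ne_top,
    lintegral_rpow_mul_exp_neg (by linarith) one_pos,
    ← ENNReal.ofReal_mul (by positivity), ← ENNReal.ofReal_mul (by positivity)]
  congr 1
  simp only [div_one, Real.one_rpow]
  ring

lemma integrable_and_integral_abs_rpow_mul_one_add {p k c m : ℝ} (hp : 0 < p) (hk : -1 < k)
    (hc : 0 < c) (hm : (k + 1) / p < m) :
    Integrable (fun x : ℝ => |x| ^ k * (1 + c * |x| ^ p) ^ (-m)) ∧
    ∫ x : ℝ, |x| ^ k * (1 + c * |x| ^ p) ^ (-m) =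
      2 * (c ^ (-(k + 1) / p) * (1 / p) * Real.Gamma ((k + 1) / p) *
        Real.Gamma (m - (k + 1) / p) / Real.Gamma m) := by
  have hs : 0 < (k + 1) / p := div_pos (by linarith) hp
  have hG : 0 < Real.Gamma m := Real.Gamma_pos_of_pos (hs.trans hm)
  have hGs : 0 < Real.Gamma ((k + 1) / p) := Real.Gamma_pos_of_pos hs
  have hGd : 0 < Real.Gamma (m - (k + 1) / p) := Real.Gamma_pos_of_pos (by linarith)
  have h := lintegral_rpow_mul_one_add_rpow hp hk hc hm
  have hnn : 0 ≤ᵐ[volume.restrict (Ioi (0 : ℝ))] fun x : ℝ => x ^ k * (1 + c * x ^ p) ^ (-m) := by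
    filter_upwards [ae_restrict_mem measurableSet_Ioi] with t ht
    have : (0 : ℝ) < t := ht
    change 0 ≤ t ^ k * (1 + c * t ^ p) ^ (-m)
    positivity
  have hmeas : Measurable fun x : ℝ => x ^ k * (1 + c * x ^ p) ^ (-m) := by fun_prop
  constructor
  · refine integrable_comp_abs_of_integrableOn_Ioi
      (g := fun x : ℝ => x ^ k * (1 + c * x ^ p) ^ (-m)) ⟨hmeas.aestronglyMeasurable, ?_⟩
    rw [hasFiniteIntegral_iff_ofReal hnn, h]
    exact ENNReal.ofReal_lt_top
  · rw [integral_comp_abs (f := fun x : ℝ => x ^ k * (1 + c * x ^ p) ^ (-m)),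
      integral_eq_lintegral_of_nonneg_ae hnn hmeas.aestronglyMeasurable, h,
      ENNReal.toReal_ofReal (by positivity)]

/-! ### Mass, p-th moment and q-norm of the generalized Gaussian density. -/

section Constants

variable {p q : ℝ}

lemma inv_lt_of_one_div_lt (hp0 : 0 < p) (hq0 : 1 / (1 + p) < q) (hq1 : q < 1) :
    1 / p < q / (1 - q) := by
  rw [div_lt_iff₀ (by linarith)] at hq0
  rw [div_lt_div_iff₀ hp0 (by linarith)]
  linarith

lemma beta_pos (hp0 : 0 < p) (hq0 : 1 / (1 + p) < q) (hq1 : q < 1) : 0 < beta p q :=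
  inv_pos.2 (sub_pos.2 (inv_lt_of_one_div_lt hp0 hq0 hq1))

lemma one_div_one_sub (hq1 : q < 1) : 1 / (1 - q) = q / (1 - q) + 1 := by
  have : 1 - q ≠ 0 := by linarith
  field_simp; ring

lemma normConst_pos (hp0 : 0 < p) (hq0 : 1 / (1 + p) < q) (hq1 : q < 1) :
    0 < normConst p q := by
  have hb := beta_pos hp0 hq0 hq1
  have h1 := inv_lt_of_one_div_lt hp0 hq0 hq1
  have h2 := one_div_one_sub hq1
  have hp' : 0 < 1 / p := by positivity
  have g1 : 0 < Real.Gamma (1 + 1 / p) := Real.Gamma_pos_of_pos (by positivity)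
  have g2 : 0 < Real.Gamma (1 / (1 - q) - 1 / p) := Real.Gamma_pos_of_pos (by linarith)
  have g3 : 0 < Real.Gamma (1 / (1 - q)) := Real.Gamma_pos_of_pos (by linarith)
  unfold normConst normConstOne
  positivity

/-- The unnormalized generalized Gaussian density. -/
noncomputable def genGaussianProfile (p q x : ℝ) : ℝ :=
  (1 + beta p q / p * |x| ^ p) ^ (-(1 / (1 - q)))

lemma integrable_profile (hp0 : 0 < p) (hq0 : 1 / (1 + p) < q) (hq1 : q < 1) :
    Integrable (genGaussianProfile p q) ∧ ∫ x, genGaussianProfile p q x = normConst p q := by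
  have hb := beta_pos hp0 hq0 hq1
  have h1 := inv_lt_of_one_div_lt hp0 hq0 hq1
  have h2 := one_div_one_sub hq1
  obtain ⟨hi, he⟩ := integrable_and_integral_abs_rpow_mul_one_add (p := p) (k := 0)
    (c := beta p q / p) (m := 1 / (1 - q)) hp0 (by norm_num) (by positivity)
    (by rw [zero_add]; linarith)
  simp only [Real.rpow_zero, one_mul, zero_add] at hi he
  refine ⟨hi, he.trans ?_⟩
  unfold normConst normConstOne
  rw [add_comm 1 (1 / p), Real.Gamma_add_one (by positivity), neg_div,
    Real.rpow_neg (by positivity), Real.div_rpow hb.le hp0.le]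
  have : 0 < beta p q ^ (1 / p) := by positivity
  have : 0 < p ^ (1 / p) := by positivity
  field_simp

/-- This is where the choice of `beta` matters. Compared with the total mass, the Gamma recursions
contribute 1/p and β, and the power of β/p contributes p/β, so the ratio is 1 and the normalized
density has p-th moment 1. -/
lemma integrable_abs_rpow_mul_profile (hp0 : 0 < p) (hq0 : 1 / (1 + p) < q) (hq1 : q < 1) :
    Integrable (fun x => |x| ^ p * genGaussianProfile p q x) ∧
      ∫ x, |x| ^ p * genGaussianProfile p q x = normConst p q := by
  have hb := beta_pos hp0 hq0 hq1
  have h1 := inv_lt_of_one_div_lt hp0 hq0 hq1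
  have h2 := one_div_one_sub hq1
  have e1 : (p + 1) / p = 1 / p + 1 := by field_simp; ring
  obtain ⟨hi, he⟩ := integrable_and_integral_abs_rpow_mul_one_add (p := p) (k := p)
    (c := beta p q / p) (m := 1 / (1 - q)) hp0 (by linarith) (by positivity)
    (by rw [e1]; linarith)
  refine ⟨hi, he.trans ?_⟩
  have hne : q / (1 - q) - 1 / p ≠ 0 := by linarith
  have e2 : 1 / (1 - q) - (p + 1) / p = q / (1 - q) - 1 / p := by rw [e1]; linarith
  have e3 : 1 / (1 - q) - 1 / p = q / (1 - q) - 1 / p + 1 := by linarith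
  have e4 : -(p + 1) / p = -(1 / p) - 1 := by field_simp; ring
  have e5 : q / (1 - q) - 1 / p = (beta p q)⁻¹ := by rw [beta, inv_inv]
  unfold normConst normConstOne
  rw [e2, e3, Real.Gamma_add_one hne, e4, e1, add_comm 1 (1 / p),
    Real.rpow_sub_one (by positivity), Real.rpow_neg (by positivity),
    Real.div_rpow hb.le hp0.le, e5]
  have : 0 < beta p q ^ (1 / p) := by positivity
  have : 0 < p ^ (1 / p) := by positivity
  field_simp

lemma genGaussianDensity_eq (p q x : ℝ) :
    genGaussianDensity p q x = (normConst p q)⁻¹ * genGaussianProfile p q x := rfl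

lemma measurable_genGaussianDensity (p q : ℝ) : Measurable (genGaussianDensity p q) := by
  unfold genGaussianDensity
  fun_prop

lemma genGaussianDensity_pos (hp0 : 0 < p) (hq0 : 1 / (1 + p) < q) (hq1 : q < 1) (x : ℝ) :
    0 < genGaussianDensity p q x := by
  have := normConst_pos hp0 hq0 hq1
  have := beta_pos hp0 hq0 hq1
  unfold genGaussianDensity
  positivity

lemma integrable_genGaussianDensity (hp0 : 0 < p) (hq0 : 1 / (1 + p) < q) (hq1 : q < 1) :
    Integrable (genGaussianDensity p q) :=
  (integrable_profile hp0 hq0 hq1).1.const_mul _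

lemma integral_genGaussianDensity (hp0 : 0 < p) (hq0 : 1 / (1 + p) < q) (hq1 : q < 1) :
    ∫ x, genGaussianDensity p q x = 1 := by
  simp_rw [genGaussianDensity_eq]
  rw [integral_const_mul, (integrable_profile hp0 hq0 hq1).2,
    inv_mul_cancel₀ (normConst_pos hp0 hq0 hq1).ne']

lemma integrable_abs_rpow_mul_genGaussianDensity (hp0 : 0 < p) (hq0 : 1 / (1 + p) < q)
    (hq1 : q < 1) : Integrable fun x => |x| ^ p * genGaussianDensity p q x := by
  refine ((integrable_abs_rpow_mul_profile hp0 hq0 hq1).1.const_mul (normConst p q)⁻¹).congr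
    (ae_of_all _ fun x => ?_)
  simp only [genGaussianDensity_eq]
  ring

lemma integral_abs_rpow_mul_genGaussianDensity (hp0 : 0 < p) (hq0 : 1 / (1 + p) < q)
    (hq1 : q < 1) : ∫ x, |x| ^ p * genGaussianDensity p q x = 1 := by
  have e : ∀ x, |x| ^ p * genGaussianDensity p q x =
      (normConst p q)⁻¹ * (|x| ^ p * genGaussianProfile p q x) := by
    intro x; rw [genGaussianDensity_eq]; ring
  simp_rw [e]
  rw [integral_const_mul, (integrable_abs_rpow_mul_profile hp0 hq0 hq1).2,
    inv_mul_cancel₀ (normConst_pos hp0 hq0 hq1).ne']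

lemma isProbabilityMeasure_genGaussian (hp0 : 0 < p) (hq0 : 1 / (1 + p) < q) (hq1 : q < 1) :
    IsProbabilityMeasure (genGaussian p q) := by
  constructor
  rw [genGaussian, withDensity_apply _ MeasurableSet.univ, Measure.restrict_univ,
    ← ofReal_integral_eq_lintegral_ofReal (integrable_genGaussianDensity hp0 hq0 hq1)
      (ae_of_all _ fun x => (genGaussianDensity_pos hp0 hq0 hq1 x).le),
    integral_genGaussianDensity hp0 hq0 hq1, ENNReal.ofReal_one]

/-- The exponents 1/(1-q) and q-1 cancel, leaving an affine function of |x|^p. This makes the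
relative entropy depend on f only through its p-th moment and its q-norm. -/
lemma genGaussianDensity_rpow_sub_one (hp0 : 0 < p) (hq0 : 1 / (1 + p) < q) (hq1 : q < 1)
    (x : ℝ) : genGaussianDensity p q x ^ (q - 1) =
      normConst p q ^ (1 - q) * (1 + beta p q / p * |x| ^ p) := by
  have hA := normConst_pos hp0 hq0 hq1
  have hb := beta_pos hp0 hq0 hq1
  have hq : 1 - q ≠ 0 := by linarith
  have h1 : 0 < 1 + beta p q / p * |x| ^ p := by positivity
  rw [genGaussianDensity, Real.mul_rpow (by positivity) (by positivity), ← Real.rpow_mul h1.le,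
    Real.inv_rpow hA.le, ← Real.rpow_neg hA.le]
  have e1 : -(1 / (1 - q)) * (q - 1) = 1 := by field_simp; ring
  rw [e1, Real.rpow_one, neg_sub]

lemma genGaussianDensity_rpow (hp0 : 0 < p) (hq0 : 1 / (1 + p) < q) (hq1 : q < 1)
    (x : ℝ) : genGaussianDensity p q x ^ q = normConst p q ^ (1 - q) *
      (genGaussianDensity p q x + beta p q / p * (|x| ^ p * genGaussianDensity p q x)) := by
  have hg := genGaussianDensity_pos hp0 hq0 hq1 x
  have : genGaussianDensity p q x ^ q =
      genGaussianDensity p q x ^ (q - 1) * genGaussianDensity p q x := by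
    rw [← Real.rpow_add_one hg.ne']; congr 1; ring
  rw [this, genGaussianDensity_rpow_sub_one hp0 hq0 hq1]
  ring

lemma integrable_genGaussianDensity_rpow (hp0 : 0 < p) (hq0 : 1 / (1 + p) < q) (hq1 : q < 1) :
    Integrable fun x => genGaussianDensity p q x ^ q := by
  simp_rw [genGaussianDensity_rpow hp0 hq0 hq1]
  exact ((integrable_genGaussianDensity hp0 hq0 hq1).add
    ((integrable_abs_rpow_mul_genGaussianDensity hp0 hq0 hq1).const_mul _)).const_mul _

lemma integral_genGaussianDensity_rpow (hp0 : 0 < p) (hq0 : 1 / (1 + p) < q) (hq1 : q < 1) :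
    ∫ x, genGaussianDensity p q x ^ q = normConst p q ^ (1 - q) * (1 + beta p q / p) := by
  simp_rw [genGaussianDensity_rpow hp0 hq0 hq1]
  rw [integral_const_mul, integral_add (integrable_genGaussianDensity hp0 hq0 hq1)
    ((integrable_abs_rpow_mul_genGaussianDensity hp0 hq0 hq1).const_mul _), integral_const_mul,
    integral_genGaussianDensity hp0 hq0 hq1, integral_abs_rpow_mul_genGaussianDensity hp0 hq0 hq1,
    mul_one]

end Constants
-- Densities, moments and norms of random variables and their multiples.
lemma map_const_mul_withDensity {g : ℝ → ℝ} (hg : Measurable g) {c : ℝ} (hc : c ≠ 0) :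
    (volume.withDensity fun x => ENNReal.ofReal (g x)).map (fun x => c * x) =
      volume.withDensity fun x => ENNReal.ofReal (|c|⁻¹ * g (c⁻¹ * x)) := by
  have hmul : Measurable fun x : ℝ => c * x := measurable_const_mul c
  have hden : Measurable fun x => ENNReal.ofReal (|c|⁻¹ * g (c⁻¹ * x)) := by fun_prop
  ext s hs
  rw [Measure.map_apply hmul hs, withDensity_apply _ (hmul hs), withDensity_apply _ hs]
  -- Only the right-hand side is rewritten with Lebesgue measure as |c| times its own image under
  -- scaling; the absolute value covers negative c.
  have hv : (volume : Measure ℝ) = ENNReal.ofReal |c| • Measure.map (fun x => c * x) volume :=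
    (Real.smul_map_volume_mul_left hc).symm
  conv_rhs => rw [hv]
  rw [Measure.restrict_smul, lintegral_smul_measure, setLIntegral_map hs hden hmul, smul_eq_mul,
    ← lintegral_const_mul' _ _ ENNReal.ofReal_ne_top]
  refine lintegral_congr fun x => ?_
  rw [← ENNReal.ofReal_mul (abs_nonneg c), inv_mul_cancel_left₀ hc,
    mul_inv_cancel_left₀ (abs_ne_zero.2 hc)]

/-- `pdf` is a Radon–Nikodym derivative, determined only almost everywhere; for this reason the
entropy lemmas below take densities up to null sets. -/
lemma pdf_ae_eq {Ω : Type*} [MeasurableSpace Ω] {P : Measure Ω} {X : Ω → ℝ} {f : ℝ → ℝ}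
    (hf : Measurable f) (hX : P.map X = volume.withDensity fun x => ENNReal.ofReal (f x)) :
    pdf X P volume =ᵐ[volume] fun x => ENNReal.ofReal (f x) := by
  rw [pdf_def, hX]
  exact Measure.rnDeriv_withDensity volume (by fun_prop)

lemma absMoment_eq {Ω : Type*} [MeasurableSpace Ω] {P : Measure Ω} {X : Ω → ℝ} {f : ℝ → ℝ}
    {p : ℝ} (hXm : AEMeasurable X P) (hf : Measurable f) (hf0 : ∀ x, 0 ≤ f x)
    (hi : Integrable fun x => |x| ^ p * f x)
    (hX : P.map X = volume.withDensity fun x => ENNReal.ofReal (f x)) :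
    absMoment p X P = ENNReal.ofReal (∫ x, |x| ^ p * f x) := by
  have h1 : absMoment p X P = ∫⁻ x, ENNReal.ofReal (|x| ^ p) ∂(P.map X) := by
    rw [lintegral_map' (by fun_prop) hXm]
    rfl
  rw [h1, hX, lintegral_withDensity_eq_lintegral_mul _ (by fun_prop) (by fun_prop),
    ofReal_integral_eq_lintegral_ofReal hi
      (ae_of_all _ fun x => mul_nonneg (by positivity) (hf0 x))]
  refine lintegral_congr fun x => ?_
  rw [Pi.mul_apply, mul_comm, ENNReal.ofReal_mul (by positivity)]

lemma absMoment_const_mul {Ω : Type*} [MeasurableSpace Ω] (P : Measure Ω) (X : Ω → ℝ) (p c : ℝ) :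
    absMoment p (fun ω => c * X ω) P = ENNReal.ofReal (|c| ^ p) * absMoment p X P := by
  unfold absMoment
  rw [← lintegral_const_mul' _ _ ENNReal.ofReal_ne_top]
  refine lintegral_congr fun ω => ?_
  rw [abs_mul, Real.mul_rpow (abs_nonneg _) (abs_nonneg _), ENNReal.ofReal_mul (by positivity)]

lemma qNorm_eq {h : ℝ → ℝ≥0∞} {f : ℝ → ℝ} {q : ℝ} (hq : 0 < q) (hf0 : ∀ x, 0 ≤ f x)
    (hi : Integrable fun x => f x ^ q) (hh : h =ᵐ[volume] fun x => ENNReal.ofReal (f x)) :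
    qNorm q h = ENNReal.ofReal ((∫ x, f x ^ q) ^ (1 / q)) := by
  unfold qNorm
  rw [eLpNorm_congr_ae hh, eLpNorm_eq_lintegral_rpow_enorm_toReal (by simpa using hq)
    ENNReal.ofReal_ne_top, ENNReal.toReal_ofReal hq.le,
    ← ENNReal.ofReal_rpow_of_nonneg (integral_nonneg fun x => Real.rpow_nonneg (hf0 x) q)
      (by positivity),
    ofReal_integral_eq_lintegral_ofReal hi (ae_of_all _ fun x => Real.rpow_nonneg (hf0 x) q)]
  congr 1
  refine lintegral_congr fun x => ?_
  rw [enorm_eq_self, ENNReal.ofReal_rpow_of_nonneg (hf0 x) hq.le]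

/-- The density of `c * Z` for `Z` with the generalized Gaussian distribution. -/
noncomputable def scaledDensity (p q c x : ℝ) : ℝ := |c|⁻¹ * genGaussianDensity p q (c⁻¹ * x)

section Scaled

variable {p q c : ℝ}

lemma measurable_scaledDensity (p q c : ℝ) : Measurable (scaledDensity p q c) := by
  have := measurable_genGaussianDensity p q
  unfold scaledDensity
  fun_prop

lemma scaledDensity_pos (hp0 : 0 < p) (hq0 : 1 / (1 + p) < q) (hq1 : q < 1) (hc : c ≠ 0) (x : ℝ) :
    0 < scaledDensity p q c x :=
  mul_pos (inv_pos.2 (abs_pos.2 hc)) (genGaussianDensity_pos hp0 hq0 hq1 _)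

lemma integral_scaledDensity_rpow (hp0 : 0 < p) (hq0 : 1 / (1 + p) < q) (hq1 : q < 1)
    (hc : c ≠ 0) : Integrable (fun x => scaledDensity p q c x ^ q) ∧
      ∫ x, scaledDensity p q c x ^ q =
        (normConst p q * |c|) ^ (1 - q) * (1 + beta p q / p) := by
  have hc' : 0 < |c| := abs_pos.2 hc
  have hA := normConst_pos hp0 hq0 hq1
  have e : ∀ x, scaledDensity p q c x ^ q = (|c|⁻¹) ^ q * genGaussianDensity p q (c⁻¹ * x) ^ q :=
    fun x => Real.mul_rpow (by positivity) (genGaussianDensity_pos hp0 hq0 hq1 _).le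
  simp_rw [e]
  refine ⟨((integrable_genGaussianDensity_rpow hp0 hq0 hq1).comp_mul_left'
    (inv_ne_zero hc)).const_mul _, ?_⟩
  rw [integral_const_mul,
    Measure.integral_comp_mul_left (fun x => genGaussianDensity p q x ^ q) c⁻¹,
    integral_genGaussianDensity_rpow hp0 hq0 hq1, inv_inv, smul_eq_mul,
    Real.mul_rpow hA.le hc'.le, Real.inv_rpow hc'.le, Real.rpow_sub hc', Real.rpow_one]
  ring

lemma scaledDensity_rpow_sub_one (hp0 : 0 < p) (hq0 : 1 / (1 + p) < q) (hq1 : q < 1)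
    (hc : c ≠ 0) (x : ℝ) : scaledDensity p q c x ^ (q - 1) =
      (normConst p q * |c|) ^ (1 - q) * (1 + beta p q / p / |c| ^ p * |x| ^ p) := by
  have hc' : 0 < |c| := abs_pos.2 hc
  have hA := normConst_pos hp0 hq0 hq1
  rw [scaledDensity, Real.mul_rpow (by positivity) (genGaussianDensity_pos hp0 hq0 hq1 _).le,
    genGaussianDensity_rpow_sub_one hp0 hq0 hq1, Real.inv_rpow hc'.le, ← Real.rpow_neg hc'.le,
    neg_sub, abs_mul, abs_inv, Real.mul_rpow (by positivity) (abs_nonneg _), Real.inv_rpow hc'.le,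
    Real.mul_rpow hA.le hc'.le]
  ring

end Scaled

/-! ### Relative entropy and its bound. -/

/-- The relative entropy in terms of the Rényi entropy of the first density. -/
lemma relEntropy_eq {f : ℝ → ℝ} {h u : ℝ → ℝ≥0∞} {p q c : ℝ} (hf : IsSymmLogConcaveDensity f)
    (hp0 : 0 < p) (hq0 : 1 / (1 + p) < q) (hq1 : q < 1) (hc : c ≠ 0)
    (hcm : |c| ^ p = ∫ x, |x| ^ p * f x)
    (hh : h =ᵐ[volume] fun x => ENNReal.ofReal (f x))
    (hu : u =ᵐ[volume] fun x => ENNReal.ofReal (scaledDensity p q c x))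
    (hR : 0 < ∫ x, f x ^ q) :
    relEntropy q h u = ((Real.log (normConst p q * |c| *
      (1 + beta p q / p) ^ (1 / (1 - q)) / (∫ x, f x ^ q) ^ (1 / (1 - q))) : ℝ) : EReal) := by
  have hqpos : 0 < q := lt_trans (by positivity) hq0
  have hq1' : 0 < 1 - q := by linarith
  have hc' : 0 < |c| := abs_pos.2 hc
  have hA := normConst_pos hp0 hq0 hq1
  have hb := beta_pos hp0 hq0 hq1
  have hu0 := scaledDensity_pos hp0 hq0 hq1 hc
  obtain ⟨hNi, hN⟩ := integral_scaledDensity_rpow hp0 hq0 hq1 hc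
  set R := ∫ x, f x ^ q with hRdef
  set B := (normConst p q * |c|) ^ (1 - q) with hB
  have hBpos : 0 < B := by positivity
  set N := B * (1 + beta p q / p) with hNdef
  have hNpos : 0 < N := by positivity
  have hm := hf.measurable
  have hmu := measurable_scaledDensity p q c
  set F := R ^ (1 / q) with hF
  set U := N ^ (1 / q) with hU
  have hFpos : 0 < F := by positivity
  have hUpos : 0 < U := by positivity
  have hint : ∫⁻ x, (h x / qNorm q h) * (u x / qNorm q u) ^ (q - 1) =
      ENNReal.ofReal (F⁻¹ * U ^ (1 - q) * N) := by
    rw [qNorm_eq hqpos hf.nonneg (hf.integrable_rpow hqpos) hh,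
      qNorm_eq hqpos (fun x => (hu0 x).le) hNi hu, hN, ← hRdef, ← hF, ← hU]
    have e1 : ∀ x, f x / F * (scaledDensity p q c x / U) ^ (q - 1) =
        F⁻¹ * U ^ (1 - q) * B * (f x + beta p q / p / |c| ^ p * (|x| ^ p * f x)) := by
      intro x
      rw [Real.div_rpow (hu0 x).le hUpos.le, scaledDensity_rpow_sub_one hp0 hq0 hq1 hc, ← hB,
        ← neg_sub 1 q, Real.rpow_neg hUpos.le]
      field_simp
    have hi : Integrable fun x => f x / F * (scaledDensity p q c x / U) ^ (q - 1) := by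
      simp_rw [e1]
      exact (hf.integrable.add ((hf.integrable_abs_rpow_mul hp0.le).const_mul _)).const_mul _
    -- Equal p-th moments make ∫ f u^(q-1) equal to N = ∫ u^q. With U = N^(1/q), the logarithm then
    -- reduces to a difference of Rényi entropies.
    have e2 : ∫ x, f x / F * (scaledDensity p q c x / U) ^ (q - 1) = F⁻¹ * U ^ (1 - q) * N := by
      simp_rw [e1]
      rw [integral_const_mul, integral_add hf.integrable
        ((hf.integrable_abs_rpow_mul hp0.le).const_mul _), integral_const_mul, hf.integral_eq_one,
        ← hcm, hNdef]
      field_simp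
    rw [← e2, ofReal_integral_eq_lintegral_ofReal hi (ae_of_all _ fun x =>
      mul_nonneg (div_nonneg (hf.nonneg x) hFpos.le)
        (Real.rpow_nonneg (div_nonneg (hu0 x).le hUpos.le) _))]
    refine lintegral_congr_ae ?_
    filter_upwards [hh, hu] with x hx hx'
    have := hu0 x
    rw [hx, hx', ← ENNReal.ofReal_div_of_pos hFpos, ← ENNReal.ofReal_div_of_pos hUpos,
      ENNReal.ofReal_rpow_of_pos (by positivity),
      ← ENNReal.ofReal_mul (div_nonneg (hf.nonneg x) hFpos.le)]
  unfold relEntropy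
  rw [hint, ENNReal.log_ofReal_of_pos (by positivity), ← EReal.coe_mul]
  congr 1
  have hb1 : 0 < 1 + beta p q / p := by positivity
  rw [Real.log_mul (by positivity) hNpos.ne', Real.log_mul (by positivity) (by positivity),
    Real.log_inv, Real.log_rpow hUpos, hU, Real.log_rpow hNpos, hF, Real.log_rpow hR,
    hNdef, Real.log_mul hBpos.ne' hb1.ne', hB, Real.log_rpow (by positivity),
    Real.log_div (by positivity) (by positivity), Real.log_rpow hR,
    Real.log_mul (mul_pos hA hc').ne' (by positivity), Real.log_rpow hb1]
  field_simp
  ring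

lemma isUniform_iff_ae_eq {Ω : Type*} [MeasurableSpace Ω] {P : Measure Ω} {X : Ω → ℝ} {f : ℝ → ℝ}
    (hf : IsSymmLogConcaveDensity f)
    (hX : P.map X = volume.withDensity fun x => ENNReal.ofReal (f x)) {a : ℝ} (ha : 0 < a) :
    pdf.IsUniform X (Icc (-a) a) P volume ↔
      f =ᵐ[volume] (Icc (-a) a).indicator fun _ => 1 / (2 * a) := by
  have hm := hf.measurable
  have hind : Measurable ((Icc (-a) a).indicator fun _ : ℝ => 1 / (2 * a)) :=
    measurable_const.indicator measurableSet_Icc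
  -- Uniformity is defined through conditioned Lebesgue measure; once this has an explicit density,
  -- equality of laws becomes almost everywhere equality of densities.
  have h1 : ProbabilityTheory.cond volume (Icc (-a) a) = volume.withDensity fun x =>
      ENNReal.ofReal ((Icc (-a) a).indicator (fun _ => 1 / (2 * a)) x) := by
    have e : (fun x => ENNReal.ofReal ((Icc (-a) a).indicator (fun _ => 1 / (2 * a)) x)) =
        (Icc (-a) a).indicator fun _ => ENNReal.ofReal (1 / (2 * a)) := by
      funext x
      by_cases hx : x ∈ Icc (-a) a
      · rw [indicator_of_mem hx, indicator_of_mem hx]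
      · rw [indicator_of_notMem hx, indicator_of_notMem hx, ENNReal.ofReal_zero]
    rw [e, withDensity_indicator measurableSet_Icc, withDensity_const, ProbabilityTheory.cond,
      Real.volume_Icc, ← ENNReal.ofReal_inv_of_pos (by linarith)]
    congr 2
    rw [one_div]; congr 1; ring
  unfold pdf.IsUniform
  rw [h1, hX, withDensity_eq_iff (by fun_prop) (by fun_prop)
    (by rw [hf.lintegral_eq_one]; exact ENNReal.one_ne_top)]
  constructor
  · intro h
    filter_upwards [h] with x hx
    refine (ENNReal.ofReal_eq_ofReal_iff (hf.nonneg x) ?_).1 hx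
    exact indicator_nonneg (fun _ _ => by positivity) x
  · intro h
    filter_upwards [h] with x hx
    rw [hx]

/-- The bound for the relative entropy of two densities with equal `p`-th moments. -/
lemma relEntropy_le_and_eq_iff {f : ℝ → ℝ} {h u : ℝ → ℝ≥0∞} {p q c : ℝ}
    (hf : IsSymmLogConcaveDensity f) (hp0 : 0 < p) (hp2 : p ≤ 2) (hq0 : 1 / (1 + p) < q)
    (hq1 : q < 1) (hc : c ≠ 0) (hcm : |c| ^ p = ∫ x, |x| ^ p * f x)
    (hh : h =ᵐ[volume] fun x => ENNReal.ofReal (f x))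
    (hu : u =ᵐ[volume] fun x => ENNReal.ofReal (scaledDensity p q c x)) :
    relEntropy q h u ≤ ((Real.log (normConst p q *
        ((1 + beta p q / p) ^ (1 / (1 - q)) / (2 * (p + 1) ^ (1 / p)))) : ℝ) : EReal) ∧
      (relEntropy q h u = ((Real.log (normConst p q *
        ((1 + beta p q / p) ^ (1 / (1 - q)) / (2 * (p + 1) ^ (1 / p)))) : ℝ) : EReal) ↔
        ∃ a : ℝ, 0 < a ∧ f =ᵐ[volume] (Icc (-a) a).indicator fun _ => 1 / (2 * a)) := by
  have hqpos : 0 < q := lt_trans (by positivity) hq0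
  have hc' : 0 < |c| := abs_pos.2 hc
  have hA := normConst_pos hp0 hq0 hq1
  have hb := beta_pos hp0 hq0 hq1
  have hle := hf.two_mul_moment_le_rpow hp0 hp2 hqpos hq1
  have hiff := hf.two_mul_moment_eq_rpow_iff hp0 hp2 hqpos hq1
  have hR : 0 < ∫ x, f x ^ q := lt_of_lt_of_le
    (mul_pos (Real.rpow_pos_of_pos hf.apply_zero_pos _) (Real.exp_pos _))
    (hf.rpow_mul_exp_le_integral_rpow hqpos)
  have hS : 2 * ((p + 1) * ∫ x, |x| ^ p * f x) ^ (1 / p) = 2 * (p + 1) ^ (1 / p) * |c| := by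
    rw [← hcm, Real.mul_rpow (by positivity) (by positivity), ← Real.rpow_mul hc'.le,
      mul_one_div_cancel hp0.ne', Real.rpow_one, mul_assoc]
  rw [hS] at hle hiff
  set D := (1 + beta p q / p) ^ (1 / (1 - q)) with hD
  have hDpos : 0 < D := by positivity
  set S := 2 * (p + 1) ^ (1 / p) with hSdef
  have hSpos : 0 < S := by positivity
  rw [relEntropy_eq hf hp0 hq0 hq1 hc hcm hh hu hR, EReal.coe_le_coe_iff, EReal.coe_eq_coe_iff,
    ← hiff, ← hD]
  set T := (∫ x, f x ^ q) ^ (1 / (1 - q)) with hT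
  have hTpos : 0 < T := by positivity
  have e : normConst p q * (D / S) = normConst p q * |c| * D / (S * |c|) := by
    field_simp
  have hM : 0 < normConst p q * |c| * D := by positivity
  rw [e]
  constructor
  · exact Real.log_le_log (by positivity) (div_le_div_of_nonneg_left hM.le (by positivity) hle)
  · constructor
    · intro h
      have h1 := Real.log_injOn_pos (mem_Ioi.2 (by positivity)) (mem_Ioi.2 (by positivity)) h
      rw [div_eq_div_iff hTpos.ne' (by positivity)] at h1
      exact mul_left_cancel₀ hM.ne' h1
    · intro h
      rw [h]

end SymmLogConcave

theorem mainTheorem9 {Ω : Type*} [MeasurableSpace Ω] (P : Measure Ω) [IsProbabilityMeasure P]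
    (X : Ω → ℝ) (hX : SymmLogConcave.HasSymmLogConcaveDistribution X P)
    (p q : ℝ) (hp0 : 0 < p) (hp2 : p ≤ 2) (hq0 : 1 / (1 + p) < q) (hq1 : q < 1) :
    -- `g_{p,q}` is a probability density, and the `p`-th moment of `X` is positive and finite
    IsProbabilityMeasure (SymmLogConcave.genGaussian p q) ∧
    0 < SymmLogConcave.absMoment p X P ∧ SymmLogConcave.absMoment p X P < ∞ ∧
    ∀ {Ω' : Type*} [MeasurableSpace Ω'] (Q : Measure Ω') [IsProbabilityMeasure Q] (Z₀ : Ω' → ℝ),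
      AEMeasurable Z₀ Q → Q.map Z₀ = SymmLogConcave.genGaussian p q →
      -- some multiple of `Z₀ = Z_{p,q}` has the same `p`-th moment as `X`
      (∃ c : ℝ, 0 < c ∧
        SymmLogConcave.absMoment p (fun ω => c * Z₀ ω) Q = SymmLogConcave.absMoment p X P) ∧
      -- and the result holds for every such multiple `Z = c * Z₀`
      ∀ (c : ℝ) (Z : Ω' → ℝ), Z = (fun ω => c * Z₀ ω) →
        SymmLogConcave.absMoment p Z Q = SymmLogConcave.absMoment p X P →
        -- the norms that occur in the relative `q`-entropy are finite
        SymmLogConcave.qNorm q (pdf X P volume) < ∞ ∧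
        SymmLogConcave.qNorm q (pdf Z Q volume) < ∞ ∧
        SymmLogConcave.relEntropy q (pdf X P volume) (pdf Z Q volume) ≤
          ((Real.log (SymmLogConcave.normConst p q *
            ((1 + SymmLogConcave.beta p q / p) ^ (1 / (1 - q)) /
              (2 * (p + 1) ^ (1 / p)))) : ℝ) : EReal) ∧
        (SymmLogConcave.relEntropy q (pdf X P volume) (pdf Z Q volume) =
          ((Real.log (SymmLogConcave.normConst p q *
            ((1 + SymmLogConcave.beta p q / p) ^ (1 / (1 - q)) /
              (2 * (p + 1) ^ (1 / p)))) : ℝ) : EReal) ↔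
          ∃ a : ℝ, 0 < a ∧ pdf.IsUniform X (Set.Icc (-a) a) P volume) := by
  obtain ⟨hXm, f, hf, hXf⟩ := hX
  have hmX := SymmLogConcave.absMoment_eq hXm hf.measurable hf.nonneg
    (hf.integrable_abs_rpow_mul hp0.le) hXf
  have hmpos := hf.moment_pos hp0.le
  have hqpos : 0 < q := lt_trans (by positivity) hq0
  refine ⟨SymmLogConcave.isProbabilityMeasure_genGaussian hp0 hq0 hq1, ?_, ?_, ?_⟩
  · rw [hmX]; exact ENNReal.ofReal_pos.2 hmpos
  · rw [hmX]; exact ENNReal.ofReal_lt_top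
  intro Ω' _ Q _ Z₀ hZ₀m hZ₀
  have hmZ₀ : SymmLogConcave.absMoment p Z₀ Q = 1 := by
    rw [SymmLogConcave.absMoment_eq hZ₀m (SymmLogConcave.measurable_genGaussianDensity p q)
      (fun x => (SymmLogConcave.genGaussianDensity_pos hp0 hq0 hq1 x).le)
      (SymmLogConcave.integrable_abs_rpow_mul_genGaussianDensity hp0 hq0 hq1) hZ₀,
      SymmLogConcave.integral_abs_rpow_mul_genGaussianDensity hp0 hq0 hq1, ENNReal.ofReal_one]
  have hmZ : ∀ c : ℝ, SymmLogConcave.absMoment p (fun ω => c * Z₀ ω) Q =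
      ENNReal.ofReal (|c| ^ p) := fun c => by
    rw [SymmLogConcave.absMoment_const_mul, hmZ₀, mul_one]
  constructor
  · refine ⟨(∫ x, |x| ^ p * f x) ^ (1 / p), by positivity, ?_⟩
    rw [hmZ, hmX, abs_of_nonneg (by positivity), ← Real.rpow_mul hmpos.le,
      one_div_mul_cancel hp0.ne', Real.rpow_one]
  rintro c Z rfl hcm
  rw [hmZ, hmX, ENNReal.ofReal_eq_ofReal_iff (by positivity) hmpos.le] at hcm
  have hc : c ≠ 0 := by
    rintro rfl
    rw [abs_zero, Real.zero_rpow hp0.ne'] at hcm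
    exact hmpos.ne hcm
  have hZ : Q.map (fun ω => c * Z₀ ω) = volume.withDensity fun x =>
      ENNReal.ofReal (SymmLogConcave.scaledDensity p q c x) := by
    have h := SymmLogConcave.map_const_mul_withDensity
      (SymmLogConcave.measurable_genGaussianDensity p q) hc
    rw [← SymmLogConcave.genGaussian, ← hZ₀,
      AEMeasurable.map_map_of_aemeasurable (by fun_prop) hZ₀m] at h
    exact h
  have hh := SymmLogConcave.pdf_ae_eq hf.measurable hXf
  have hu := SymmLogConcave.pdf_ae_eq (SymmLogConcave.measurable_scaledDensity p q c) hZ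
  obtain ⟨h1, h2⟩ := SymmLogConcave.relEntropy_le_and_eq_iff hf hp0 hp2 hq0 hq1 hc hcm hh hu
  refine ⟨?_, ?_, h1, ?_⟩
  · rw [SymmLogConcave.qNorm_eq hqpos hf.nonneg (hf.integrable_rpow hqpos) hh]
    exact ENNReal.ofReal_lt_top
  · rw [SymmLogConcave.qNorm_eq hqpos
      (fun x => (SymmLogConcave.scaledDensity_pos hp0 hq0 hq1 hc x).le)
      (SymmLogConcave.integral_scaledDensity_rpow hp0 hq0 hq1 hc).1 hu]
    exact ENNReal.ofReal_lt_top
  · rw [h2]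
    exact exists_congr fun a => and_congr_right fun ha =>
      (SymmLogConcave.isUniform_iff_ae_eq hf hXf ha).symm
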